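/- Let $a^{j,m,p,n}_{k,l}\in\mathbb R$ ($1\le j,k,l,m,n,p\le 3$) be given, let $\nu>0$, and for vector fields $u,v$ on $\mathbb R^3$ put $$Q^j(u,v)=\sum_{k,l,m=1}^3 q^{j,m}_{k,l}\bigl(\partial_m(u^kv^l)\bigr),\qquad q^{j,m}_{k,l}(b)=\sum_{n,p=1}^3a^{j,m,p,n}_{k,l}\,\mathcal F^{-1}\Bigl(\frac{\xi_n\xi_p}{|\xi|^2}\,\widehat b(\xi)\Bigr),\qquad j=1,2,3.$$ Consider the generalized Navier--Stokes system $$\partial_tu-\nu\Delta u=Q(u,u)\quad(t>0,\ x\in\mathbb R^3),\qquad u(\cdot,0)=u_0.\tag{$GNS_\nu$}$$ For $i\in\{-1,0,1\}$ let $\chi^i$ be the space of tempered distributions $f$ on $\mathbb R^3$ (with values in $\mathbb C^3$) whose Fourier transform is a locally integrable function with $\|f\|_{\chi^i}=\int_{\mathbb R^3}|\xi|^i|\widehat f(\xi)|\,d\xi<\infty$. A mild solution on $[0,T]$ is a $u\in L^2([0,T];\chi^0)$ with $$u(t)=e^{\nu t\Delta}u_0+\int_0^te^{\nu(t-s)\Delta}Q(u(s),u(s))\,ds\qquad\text{for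 almost every }t\in[0,T];$$ functions of time that agree almost everywhere are identified. **Theorem.** Let $u_0\in\chi^{-1}$. There is a $T>0$ such that $(GNS_\nu)$ has a unique mild solution $u$ in $L^2([0,T];\chi^0)$. This solution also belongs to $$C([0,T];\chi^{-1})\cap L^1([0,T];\chi^1)\cap L^\infty([0,T];\chi^{-1}),\qquad\text{and } u(0)=u_0.$$ Let $T_{u_0}\in(0,\infty]$ be the maximal time of existence of such a solution, that is, the supremum of the $T>0$ for which there is one on $[0,T]$. There is a function $u$ on $[0,T_{u_0})$ which is such a solution on $[0,T]$ for every $0<T<T_{u_0}$; for every $T>0$, every mild solution on $[0,T]$ agrees with $u$ almost everywhere; and $u$ is real valued if $u_0$ is. Moreover: (i) There is a constant $C>0$, depending only on the coefficients $a^{j,m,p,n}_{k,l}$ (not on $\nu$ or $u_0$), such that $\|u_0\|_{\chi^{-1}}\le C\nu$ implies $T_{u_0}=\infty$. (ii) If $T_{u_0}<\infty$, then $\displaystyle\int_0^{T_{u_0}}\|u(t)\|_{\chi^0}^2\,dt=\infty$. -/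

import Mathlib

open MeasureTheory Set
open scoped SchwartzMap FourierTransform LineDeriv ENNReal

noncomputable section

namespace GNS

/-- Physical space `ℝ³`. -/
abbrev R3 := EuclideanSpace ℝ (Fin 3)

/-- Values of vector fields. Fields may be complex valued; see `IsRealField` for real ones. -/
abbrev C3 := EuclideanSpace ℂ (Fin 3)

section Spaces

variable {F : Type*} [NormedAddCommGroup F] [NormedSpace ℂ F]

/-- The tempered distribution `T` is (given by integration against) the function `g`. -/
def Represents (T : 𝓢'(R3, F)) (g : R3 → F) : Prop :=
  LocallyIntegrable g ∧ (∀ φ : 𝓢(R3, ℂ), Integrable fun x => φ x • g x) ∧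
    ∀ φ : 𝓢(R3, ℂ), T φ = ∫ x, φ x • g x

/-- `∫ |ξ|^i |f̂(ξ)| dξ`, which is `∞` if `f̂` is not a function. (The function representing `f̂` is
unique almost everywhere, so the infimum is over equal numbers: `chiENorm_eq`.) -/
def chiENorm (i : ℤ) (f : 𝓢'(R3, F)) : ℝ≥0∞ :=
  ⨅ (g : R3 → F) (_ : Represents (𝓕 f) g), ∫⁻ ξ, ENNReal.ofReal (‖ξ‖ ^ i) * ‖g ξ‖ₑ

theorem Represents.ae_eq [CompleteSpace F] {T : 𝓢'(R3, F)} {g h : R3 → F}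
    (hg : Represents T g) (hh : Represents T h) : g =ᵐ[volume] h := by
  refine ae_eq_of_integral_contDiff_smul_eq hg.1 hh.1 fun φ φ_smooth φ_cpt => ?_
  have h₁ : HasCompactSupport (Complex.ofRealCLM ∘ φ) := φ_cpt.comp_left rfl
  have h₂ : ContDiff ℝ (⊤ : ℕ∞) (Complex.ofRealCLM ∘ φ) := by fun_prop
  have := (hg.2.2 (h₁.toSchwartzMap h₂)).symm.trans (hh.2.2 (h₁.toSchwartzMap h₂))
  simpa using this

theorem Represents.zero : Represents (0 : 𝓢'(R3, F)) 0 :=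
  ⟨locallyIntegrable_zero, fun φ => by simp, fun φ => by simp⟩

theorem Represents.add {T S : 𝓢'(R3, F)} {g h : R3 → F}
    (hg : Represents T g) (hh : Represents S h) : Represents (T + S) (g + h) := by
  refine ⟨hg.1.add hh.1, fun φ => ?_, fun φ => ?_⟩
  · simp only [Pi.add_apply, smul_add]
    exact (hg.2.1 φ).add (hh.2.1 φ)
  · have := integral_add (hg.2.1 φ) (hh.2.1 φ)
    simp only [Pi.add_apply, smul_add]
    rw [this, ← hg.2.2, ← hh.2.2]
    rfl

theorem Represents.smul (c : ℂ) {T : 𝓢'(R3, F)} {g : R3 → F}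
    (hg : Represents T g) : Represents (c • T) (c • g) := by
  refine ⟨hg.1.smul c, fun φ => ?_, fun φ => ?_⟩
  · simp only [Pi.smul_apply, smul_comm _ c]
    exact (hg.2.1 φ).smul c
  · simp only [Pi.smul_apply, smul_comm _ c]
    rw [integral_smul, ← hg.2.2]
    rfl

theorem chiENorm_eq [CompleteSpace F] (i : ℤ) {f : 𝓢'(R3, F)} {g : R3 → F}
    (hg : Represents (𝓕 f) g) :
    chiENorm i f = ∫⁻ ξ, ENNReal.ofReal (‖ξ‖ ^ i) * ‖g ξ‖ₑ := by
  refine le_antisymm (iInf₂_le g hg) (le_iInf₂ fun h hh => le_of_eq (lintegral_congr_ae ?_))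
  filter_upwards [hg.ae_eq hh] with ξ hξ
  rw [hξ]

theorem exists_represents {i : ℤ} {f : 𝓢'(R3, F)} (hf : chiENorm i f < ∞) :
    ∃ g, Represents (𝓕 f) g := by
  by_contra! h
  simp [chiENorm, h] at hf

variable [CompleteSpace F]

theorem chiENorm_add_le (i : ℤ) (f g : 𝓢'(R3, F)) :
    chiENorm i (f + g) ≤ chiENorm i f + chiENorm i g := by
  rcases eq_or_ne (chiENorm i f) ∞ with hf | hf
  · simp [hf]
  rcases eq_or_ne (chiENorm i g) ∞ with hg | hg
  · simp [hg]
  obtain ⟨a, ha⟩ := exists_represents hf.lt_top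
  obtain ⟨b, hb⟩ := exists_represents hg.lt_top
  have hab : Represents (𝓕 (f + g)) (a + b) := by
    rw [FourierTransform.fourier_add]; exact ha.add hb
  rw [chiENorm_eq i ha, chiENorm_eq i hb, chiENorm_eq i hab, ← lintegral_add_left']
  · refine lintegral_mono fun ξ => ?_
    rw [← mul_add]
    gcongr
    exact enorm_add_le _ _
  · refine AEMeasurable.mul ?_ ha.1.aestronglyMeasurable.enorm
    exact (Measurable.ennreal_ofReal (by fun_prop)).aemeasurable

theorem chiENorm_smul (i : ℤ) (c : ℂ) {f : 𝓢'(R3, F)} (hf : chiENorm i f < ∞) :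
    chiENorm i (c • f) = ‖c‖ₑ * chiENorm i f := by
  obtain ⟨a, ha⟩ := exists_represents hf
  have hca : Represents (𝓕 (c • f)) (c • a) := by
    rw [FourierTransform.fourier_smul]; exact ha.smul c
  rw [chiENorm_eq i ha, chiENorm_eq i hca, ← lintegral_const_mul' _ _ enorm_ne_top]
  refine lintegral_congr fun ξ => ?_
  simp only [Pi.smul_apply, enorm_smul]
  ring

theorem chiENorm_zero (i : ℤ) : chiENorm i (0 : 𝓢'(R3, F)) = 0 := by
  have h : Represents (𝓕 (0 : 𝓢'(R3, F))) 0 := by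
    rw [FourierTransform.fourier_zero]; exact Represents.zero
  simp [chiENorm_eq i h]

theorem eq_zero_of_chiENorm {i : ℤ} {f : 𝓢'(R3, F)} (hf : chiENorm i f = 0) : f = 0 := by
  obtain ⟨a, ha⟩ := exists_represents (i := i) (f := f) (by simp [hf])
  rw [chiENorm_eq i ha, lintegral_eq_zero_iff'] at hf
  · have ha0 : a =ᵐ[volume] 0 := by
      have h0 : ∀ᵐ ξ : R3, ξ ≠ 0 := by simp [ae_iff]
      filter_upwards [hf, h0] with ξ h1 h2
      have : 0 < ‖ξ‖ ^ i := zpow_pos (norm_pos_iff.2 h2) i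
      have h3 : ¬ ‖ξ‖ ^ i ≤ 0 := not_le.2 this
      simpa [h3] using h1
    have hF : 𝓕 f = 0 := by
      ext φ
      rw [ha.2.2 φ]
      refine (integral_eq_zero_of_ae ?_)
      filter_upwards [ha0] with ξ h
      simp [h]
    have := congrArg (fun T => 𝓕⁻ T) hF
    simpa [FourierTransform.fourierInv_zero] using this
  · refine AEMeasurable.mul ?_ ha.1.aestronglyMeasurable.enorm
    exact (Measurable.ennreal_ofReal (by fun_prop)).aemeasurable

variable (F) in
/-- `χ^i` as a linear subspace of the tempered distributions. -/
def chiSubmodule (i : ℤ) : Submodule ℂ 𝓢'(R3, F) where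
  carrier := {f | chiENorm i f < ∞}
  zero_mem' := by simp [chiENorm_zero]
  add_mem' := fun {f g} hf hg =>
    (chiENorm_add_le i f g).trans_lt (ENNReal.add_lt_top.2 ⟨hf, hg⟩)
  smul_mem' := fun c f hf => by
    simp only [mem_ofPred_eq] at hf ⊢
    rw [chiENorm_smul i c hf]
    exact ENNReal.mul_lt_top enorm_lt_top hf

variable (F) in
/-- The space `χ^i = {f ∈ 𝓢' : ∫ |ξ|^i |f̂(ξ)| dξ < ∞}`. It is not an `abbrev`: its topology is that
of the norm below and not that of `𝓢'`. -/
def Chi (i : ℤ) : Type _ := chiSubmodule F i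

/-- The underlying tempered distribution. -/
def Chi.toDist {i : ℤ} (f : Chi F i) : 𝓢'(R3, F) := Subtype.val f

instance (i : ℤ) : AddCommGroup (Chi F i) := inferInstanceAs (AddCommGroup (chiSubmodule F i))

instance (i : ℤ) : Module ℂ (Chi F i) := inferInstanceAs (Module ℂ (chiSubmodule F i))

instance (i : ℤ) : Norm (Chi F i) := ⟨fun f => (chiENorm i f.toDist).toReal⟩

theorem Chi.core (i : ℤ) : NormedSpace.Core ℂ (Chi F i) where
  norm_nonneg _ := ENNReal.toReal_nonneg
  norm_smul c f := by
    have h := congrArg ENNReal.toReal (chiENorm_smul i c (f := f.toDist) f.2)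
    rw [ENNReal.toReal_mul, toReal_enorm] at h
    exact h
  norm_triangle f g := by
    have hf : chiENorm i f.toDist ≠ ∞ := f.2.ne
    have hg : chiENorm i g.toDist ≠ ∞ := g.2.ne
    have h := ENNReal.toReal_mono (ENNReal.add_ne_top.2 ⟨hf, hg⟩)
      (chiENorm_add_le i f.toDist g.toDist)
    rw [ENNReal.toReal_add hf hg] at h
    exact h
  norm_eq_zero_iff f := by
    constructor
    · intro h
      rcases (ENNReal.toReal_eq_zero_iff _).1 h with h | h
      · exact Subtype.ext (eq_zero_of_chiENorm h)
      · exact absurd h f.2.ne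
    · rintro rfl
      change (chiENorm i (0 : 𝓢'(R3, F))).toReal = 0
      simp [chiENorm_zero]

instance (i : ℤ) : NormedAddCommGroup (Chi F i) := NormedAddCommGroup.ofCore (Chi.core i)

instance (i : ℤ) : NormedSpace ℂ (Chi F i) := NormedSpace.ofCore (Chi.core i)

/-- `u ∈ L^p([0,T]; χ^i)` in the sense of Bochner. -/
def MemLpChi (p : ℝ≥0∞) (i : ℤ) (T : ℝ) (u : ℝ → 𝓢'(R3, F)) : Prop :=
  ∃ v : ℝ → Chi F i, MemLp v p (volume.restrict (Icc 0 T)) ∧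
    ∀ᵐ t ∂volume.restrict (Icc 0 T), (v t).toDist = u t

/-- `u ∈ C([0,T]; χ^i)`. -/
def ContinuousChi (i : ℤ) (T : ℝ) (u : ℝ → 𝓢'(R3, F)) : Prop :=
  ∃ v : ℝ → Chi F i, ContinuousOn v (Icc 0 T) ∧ ∀ t ∈ Icc 0 T, (v t).toDist = u t

end Spaces

section Operators

variable {F : Type*} [NormedAddCommGroup F] [NormedSpace ℂ F]

open Classical in
/-- The function that represents `T`; meaningful if there is one. -/
def funOf (T : 𝓢'(R3, F)) : R3 → F := if h : ∃ g, Represents T g then h.choose else 0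

open Classical in
/-- The tempered distribution given by the function `g`; meaningful if `g` defines one. -/
def distOf (g : R3 → F) : 𝓢'(R3, F) := if h : ∃ T, Represents T g then h.choose else 0

/-- The product `u^k v^l` of two components of the fields `u` and `v`, as a pointwise product. -/
def prodComp (k l : Fin 3) (u v : 𝓢'(R3, C3)) : 𝓢'(R3, ℂ) :=
  distOf fun x => funOf u x k * funOf v x l

/-- The Fourier multiplier `b ↦ 𝓕⁻¹ (ξ_n ξ_p / |ξ|² * b̂)`. -/
def riesz (n p : Fin 3) (b : 𝓢'(R3, ℂ)) : 𝓢'(R3, ℂ) :=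
  𝓕⁻ (distOf fun ξ : R3 => ((ξ n * ξ p / ‖ξ‖ ^ 2 : ℝ) : ℂ) * funOf (𝓕 b) ξ)

/-- Real coefficients `a j m p n k l`, written `a^{j,m,p,n}_{k,l}`. -/
abbrev Coeffs := Fin 3 → Fin 3 → Fin 3 → Fin 3 → Fin 3 → Fin 3 → ℝ

/-- `q^{j,m}_{k,l}(b) = ∑_{n,p} a^{j,m,p,n}_{k,l} 𝓕⁻¹ (ξ_n ξ_p / |ξ|² * b̂)`. -/
def qOp (a : Coeffs) (j m k l : Fin 3) (b : 𝓢'(R3, ℂ)) : 𝓢'(R3, ℂ) :=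
  ∑ n, ∑ p, (a j m p n k l : ℂ) • riesz n p b

/-- `Q^j(u,v) = ∑_{k,l,m} q^{j,m}_{k,l}(∂_m (u^k v^l))`. -/
def Q (a : Coeffs) (j : Fin 3) (u v : 𝓢'(R3, C3)) : 𝓢'(R3, ℂ) :=
  ∑ k, ∑ l, ∑ m, qOp a j m k l (∂_{EuclideanSpace.single m (1 : ℝ)} (prodComp k l u v))

/-- The heat semigroup `e^{τΔ}`, `τ ≥ 0`. The Fourier transform is `∫ e^{-2πi x·ξ} f(x) dx`, so that
`Δ` has the symbol `-(2π|ξ|)²`. -/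
def heat (τ : ℝ) (f : 𝓢'(R3, F)) : 𝓢'(R3, F) :=
  TemperedDistribution.fourierMultiplierCLM F
    (fun ξ : R3 => ((Real.exp (-τ * (2 * Real.pi * ‖ξ‖) ^ 2) : ℝ) : ℂ)) f

end Operators

/-- `u` is a mild solution in `L²([0,T]; χ⁰)` of `∂ₜu - νΔu = Q(u,u)`, `u(0) = u₀`:
`u(t) = e^{νtΔ} u₀ + ∫₀ᵗ e^{ν(t-s)Δ} Q(u(s),u(s)) ds` for almost every `t ∈ [0,T]`, the integral of
distributions being tested against Schwartz functions. -/
structure IsMildSolution (a : Coeffs) (ν : ℝ) (u₀ : 𝓢'(R3, C3)) (T : ℝ) (u : ℝ → 𝓢'(R3, C3)) :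
    Prop where
  memLp : MemLpChi 2 0 T u
  duhamel : ∀ᵐ t ∂volume.restrict (Icc 0 T), ∀ (φ : 𝓢(R3, ℂ)) (j : Fin 3),
    u t φ j = heat (ν * t) u₀ φ j + ∫ s in (0 : ℝ)..t, heat (ν * (t - s)) (Q a j (u s) (u s)) φ

/-- A mild solution in `L²([0,T]; χ⁰)` (more precisely, that representative of its class which is
continuous in time and takes the value `u₀` at time `0`) that belongs to
`C([0,T]; χ⁻¹) ∩ L¹([0,T]; χ¹) ∩ L^∞([0,T]; χ⁻¹)`. -/
structure IsRegularSolution (a : Coeffs) (ν : ℝ) (u₀ : 𝓢'(R3, C3)) (T : ℝ) (u : ℝ → 𝓢'(R3, C3)) :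
    Prop where
  mild : IsMildSolution a ν u₀ T u
  initial : u 0 = u₀
  continuous : ContinuousChi (-1) T u
  memL1 : MemLpChi 1 1 T u
  memLinfty : MemLpChi ∞ (-1) T u

/-- The maximal time of existence `T_{u₀} ∈ [0,∞]` of a solution. -/
def lifespan (a : Coeffs) (ν : ℝ) (u₀ : 𝓢'(R3, C3)) : ℝ≥0∞ :=
  ⨆ (T : ℝ) (_ : 0 < T ∧ ∃ u, IsRegularSolution a ν u₀ T u), ENNReal.ofReal T

/-- The field is real valued: its components are real on real test functions. -/
def IsRealField (f : 𝓢'(R3, C3)) : Prop :=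
  ∀ φ : 𝓢(R3, ℂ), (∀ x, (φ x).im = 0) → ∀ k, (f φ k).im = 0

end GNS

end

/-!
On the Fourier side the equation is a quadratic fixed point problem. Write `û₀ = |ξ| f₀` with
`f₀ ∈ L¹` and `U(t) = û(t) ∈ L¹`. Then `U = L f₀ + D B(U, U)`, where `B` is a bounded bilinear map
on `L¹` (a multiplier homogeneous of degree `0` applied to a convolution; the derivative in `Q` is
split off as a factor `|ξ|`) and `D` is the Duhamel operator with kernel
`k_t(ξ) = |ξ| exp(-4π²ν t |ξ|²)`. Since `∫ k_t(ξ)² dt = 1 / (8π²ν)` does not depend on `ξ`,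
Minkowski's inequality shows that `D` maps `L¹` in time to `L²` in time and that `L f₀`, which is
`k_t f₀`, lies in `L²` in time. So both sides live in `L²([0,T]; L¹)`, the equation is scaling
critical, and it can be solved when `L f₀` is small: for every `T` if `f₀` is small, and for small
`T` otherwise, because the `L²` norm is absolutely continuous. The same absolute continuity extends
every solution beyond its final time and, as `D` is causal, gives uniqueness. The regularity comes
from the kernels `exp(-4π²ν t |ξ|²)`, which is bounded and continuous in time, and
`|ξ|² exp(-4π²ν t |ξ|²)`, which is integrable in time uniformly in `ξ`. A solution of finite `L²`
norm on `[0, T_{u₀})` would be a mild solution up to time `T_{u₀}` and could be extended past it,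
and a solution with real data is real because it agrees with its complex conjugate.
-/

noncomputable section

namespace GNS

open Filter Topology
open scoped ComplexConjugate Convolution

section MulLp

variable {α 𝕜 E : Type*} [MeasurableSpace α] {μ : Measure α} [NormedField 𝕜] [NormedAlgebra ℝ 𝕜]
  [NormedAddCommGroup E] [NormedSpace ℝ E] [NormedSpace 𝕜 E] [IsScalarTower ℝ 𝕜 E]
  {p : ℝ≥0∞} [Fact (1 ≤ p)] {σ : α → 𝕜}

open Classical in
variable (E μ p) in
/-- Multiplication by the bounded function `σ` on `L^p`; it is `0` if `σ` is not in `L^∞`. -/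
def mulLp (σ : α → 𝕜) : Lp E p μ →L[ℝ] Lp E p μ :=
  if h : MemLp σ ∞ μ then (ContinuousLinearMap.lsmul ℝ 𝕜).holderL μ ∞ p p h.toLp else 0

theorem coeFn_mulLp (hσ : MemLp σ ∞ μ) (f : Lp E p μ) :
    mulLp E μ p σ f =ᵐ[μ] fun x => σ x • f x := by
  rw [mulLp, dif_pos hσ]
  have h := (ContinuousLinearMap.lsmul ℝ 𝕜 (E := E)).coeFn_holder (r := p) hσ.toLp f
  filter_upwards [h, hσ.coeFn_toLp] with x h_holder hσx
  rw [ContinuousLinearMap.holderL_apply_apply, h_holder, hσx]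
  rfl

theorem norm_mulLp_apply_le (hσ : MemLp σ ∞ μ) {C : ℝ} (hC : ∀ x, ‖σ x‖ ≤ C) (f : Lp E p μ) :
    ‖mulLp E μ p σ f‖ ≤ C * ‖f‖ := by
  refine Lp.norm_le_mul_norm_of_ae_le_mul ?_
  filter_upwards [coeFn_mulLp hσ f] with x hx
  rw [hx, norm_smul]
  exact mul_le_mul_of_nonneg_right (hC x) (norm_nonneg _)

theorem mulLp_zero : mulLp E μ p (0 : α → 𝕜) = 0 := by
  ext1 f
  refine Lp.ext ?_
  filter_upwards [coeFn_mulLp (σ := (0 : α → 𝕜)) MemLp.zero f, Lp.coeFn_zero E p μ] with x hx h0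
  rw [hx, zero_apply, h0, Pi.zero_apply, zero_smul, Pi.zero_apply]

end MulLp

section Minkowski

theorem eLpNorm_two_le_iff {α E : Type*} [MeasurableSpace α] {μ : Measure α}
    [NormedAddCommGroup E] {f : α → E} {C : ℝ≥0∞} :
    eLpNorm f 2 μ ≤ C ↔ ∫⁻ x, ‖f x‖ₑ ^ 2 ∂μ ≤ C ^ 2 := by
  rw [eLpNorm_eq_lintegral_rpow_enorm_toReal two_ne_zero ENNReal.ofNat_ne_top,
    ENNReal.toReal_ofNat, one_div, ENNReal.rpow_inv_le_iff two_pos]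
  simp only [ENNReal.rpow_ofNat]

variable {α β : Type*} [MeasurableSpace α] [MeasurableSpace β] {μ : Measure α} {ν : Measure β}

theorem lintegral_mul_le_of_lintegral_sq_le {f g : α → ℝ≥0∞} (hf : AEMeasurable f μ)
    (hg : AEMeasurable g μ) {A B : ℝ≥0∞} (hA : ∫⁻ x, f x ^ 2 ∂μ ≤ A ^ 2)
    (hB : ∫⁻ x, g x ^ 2 ∂μ ≤ B ^ 2) : ∫⁻ x, f x * g x ∂μ ≤ A * B := by
  refine (ENNReal.lintegral_mul_le_Lp_mul_Lq μ Real.HolderConjugate.two_two hf hg).trans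
    (mul_le_mul' ?_ ?_) <;>
  · rw [one_div, ENNReal.rpow_inv_le_iff two_pos]
    exact_mod_cast ‹_›

theorem sq_lintegral_eq_lintegral_lintegral_mul {f : β → ℝ≥0∞} (hf : AEMeasurable f ν) :
    (∫⁻ s, f s ∂ν) ^ 2 = ∫⁻ s, ∫⁻ s', f s * f s' ∂ν ∂ν := by
  rw [sq, ← lintegral_mul_const'' _ hf]
  exact lintegral_congr fun s => (lintegral_const_mul'' _ hf).symm

/-- Minkowski's integral inequality for the exponent `2`. -/
theorem lintegral_sq_lintegral_le [SFinite μ] [SFinite ν] {h : α → β → ℝ≥0∞}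
    (hh : AEMeasurable (Function.uncurry h) (μ.prod ν)) {N : β → ℝ≥0∞} (hN : AEMeasurable N ν)
    (hhN : ∀ᵐ s ∂ν, ∫⁻ t, h t s ^ 2 ∂μ ≤ N s ^ 2) :
    ∫⁻ t, (∫⁻ s, h t s ∂ν) ^ 2 ∂μ ≤ (∫⁻ s, N s ∂ν) ^ 2 := by
  have h_left : ∀ᵐ t ∂μ, AEMeasurable (h t) ν :=
    hh.aestronglyMeasurable.prodMk_left.mono fun _ h => h.aemeasurable
  have h_right : ∀ᵐ s ∂ν, AEMeasurable (fun t => h t s) μ :=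
    hh.prod_swap.aestronglyMeasurable.prodMk_left.mono fun _ h => h.aemeasurable
  calc ∫⁻ t, (∫⁻ s, h t s ∂ν) ^ 2 ∂μ
      = ∫⁻ t, ∫⁻ s, ∫⁻ s', h t s * h t s' ∂ν ∂ν ∂μ :=
        lintegral_congr_ae (h_left.mono fun _ => sq_lintegral_eq_lintegral_lintegral_mul)
    _ = ∫⁻ s, ∫⁻ t, ∫⁻ s', h t s * h t s' ∂ν ∂μ ∂ν := by
        refine lintegral_lintegral_swap (AEMeasurable.congr (f := fun z : α × β =>
          h z.1 z.2 * ∫⁻ s', h z.1 s' ∂ν) ?_ ?_)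
        · exact hh.mul (hh.lintegral_prod_right'.comp_quasiMeasurePreserving
            Measure.quasiMeasurePreserving_fst)
        · filter_upwards [Measure.quasiMeasurePreserving_fst.ae h_left] with z hz
          exact (lintegral_const_mul'' _ hz).symm
    _ ≤ ∫⁻ s, ∫⁻ s', N s * N s' ∂ν ∂ν := by
        refine lintegral_mono_ae ?_
        filter_upwards [hhN, h_right] with s hs hs_meas
        rw [lintegral_lintegral_swap
          ((hs_meas.comp_quasiMeasurePreserving Measure.quasiMeasurePreserving_fst).mul hh)]
        refine lintegral_mono_ae ?_
        filter_upwards [hhN, h_right] with s' hs' hs'_meas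
        exact lintegral_mul_le_of_lintegral_sq_le hs_meas hs'_meas hs hs'
    _ = (∫⁻ s, N s ∂ν) ^ 2 := (sq_lintegral_eq_lintegral_lintegral_mul hN).symm

end Minkowski

section Duhamel

variable {E F : Type*} [NormedAddCommGroup E] [NormedSpace ℝ E] [NormedAddCommGroup F]
  [NormedSpace ℝ F]

/-- The time convolution `∫ H(t - s) f(s) ds` over the whole line. If `H` vanishes for negative
times and `f` lives on positive ones, it is the Duhamel integral over `[0, t]`. -/
def duhamel (H : ℝ → F →L[ℝ] E) (f : ℝ → F) (t : ℝ) : E := ∫ s, H (t - s) (f s)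

theorem duhamel_congr (H : ℝ → F →L[ℝ] E) {f g : ℝ → F} (h : f =ᵐ[volume] g) :
    duhamel H f = duhamel H g := by
  ext1 t
  refine integral_congr_ae ?_
  filter_upwards [h] with s hs
  rw [hs]

theorem map_duhamel [CompleteSpace E] {G : Type*} [NormedAddCommGroup G] [NormedSpace ℝ G]
    [CompleteSpace G] (ℓ : E →L[ℝ] G) (H : ℝ → F →L[ℝ] E) {f : ℝ → F} {t : ℝ}
    (h : Integrable fun s => H (t - s) (f s)) :
    ℓ (duhamel H f t) = ∫ s, ℓ (H (t - s) (f s)) :=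
  (ℓ.integral_comp_comm h).symm

variable [SecondCountableTopology F] {H : ℝ → F →L[ℝ] E} {f : ℝ → F}

theorem aestronglyMeasurable_kernel_comp {α : Type*} [MeasurableSpace α] {μ : Measure α}
    (hH : ∀ x, StronglyMeasurable fun τ => H τ x) {τ : α → ℝ} (hτ : Measurable τ)
    {g : α → F} (hg : AEStronglyMeasurable g μ) :
    AEStronglyMeasurable (fun z => H (τ z) (g z)) μ := by
  borelize F
  have hH_uncurry : StronglyMeasurable fun z : F × ℝ => H z.2 z.1 :=
    stronglyMeasurable_uncurry_of_continuous_of_stronglyMeasurable (u := fun x τ => H τ x)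
      (fun τ => (H τ).continuous) hH
  refine ⟨fun z => H (τ z) (hg.mk g z), hH_uncurry.comp_measurable
    (hg.stronglyMeasurable_mk.measurable.prodMk hτ), ?_⟩
  filter_upwards [hg.ae_eq_mk] with z hz
  rw [hz]

theorem aestronglyMeasurable_kernel_sub_comp (hH : ∀ x, StronglyMeasurable fun τ => H τ x)
    (hf : AEStronglyMeasurable f) :
    AEStronglyMeasurable (fun z : ℝ × ℝ => H (z.1 - z.2) (f z.2)) (volume.prod volume) :=
  aestronglyMeasurable_kernel_comp hH (measurable_fst.sub measurable_snd)
    (hf.comp_quasiMeasurePreserving Measure.quasiMeasurePreserving_snd)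

theorem lintegral_lintegral_kernel_le (hH : ∀ x, StronglyMeasurable fun τ => H τ x) {C : ℝ≥0∞}
    (hC : ∀ x, ∫⁻ τ, ‖H τ x‖ₑ ≤ C * ‖x‖ₑ) (hf : AEStronglyMeasurable f) :
    ∫⁻ t, ∫⁻ s, ‖H (t - s) (f s)‖ₑ ≤ C * ∫⁻ s, ‖f s‖ₑ := by
  rw [lintegral_lintegral_swap (f := fun t s => ‖H (t - s) (f s)‖ₑ)
    (aestronglyMeasurable_kernel_sub_comp hH hf).enorm, ← lintegral_const_mul'' _ hf.enorm]
  refine lintegral_mono fun s => ?_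
  rw [lintegral_sub_right_eq_self (fun t => ‖H t (f s)‖ₑ) s]
  exact hC _

theorem lintegral_sq_lintegral_kernel_le (hH : ∀ x, StronglyMeasurable fun τ => H τ x)
    {C : ℝ≥0∞} (hC : ∀ x, ∫⁻ τ, ‖H τ x‖ₑ ^ 2 ≤ (C * ‖x‖ₑ) ^ 2) (hf : AEStronglyMeasurable f) :
    ∫⁻ t, (∫⁻ s, ‖H (t - s) (f s)‖ₑ) ^ 2 ≤ (C * ∫⁻ s, ‖f s‖ₑ) ^ 2 := by
  rw [← lintegral_const_mul'' _ hf.enorm]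
  refine lintegral_sq_lintegral_le (aestronglyMeasurable_kernel_sub_comp hH hf).enorm
    (hf.enorm.const_mul _) (Eventually.of_forall fun s => ?_)
  rw [lintegral_sub_right_eq_self (fun t => ‖H t (f s)‖ₑ ^ 2) s]
  exact hC _

end Duhamel

/-- A causal family of operators `F → E` that maps `F` boundedly to `L²(ℝ; E)`. Convolution in
time with it maps `L¹(ℝ; F)` to `L²(ℝ; E)`. -/
structure SmoothingKernel (F E : Type*) [NormedAddCommGroup F] [NormedSpace ℝ F]
    [NormedAddCommGroup E] [NormedSpace ℝ E] where
  /-- the operator at each time -/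
  op : ℝ → F →L[ℝ] E
  /-- a bound for the norm of `x ↦ (τ ↦ op τ x)` from `F` to `L²(ℝ; E)` -/
  bound : NNReal
  stronglyMeasurable : ∀ x, StronglyMeasurable fun τ => op τ x
  causal : ∀ τ ≤ 0, op τ = 0
  lintegral_le : ∀ x, ∫⁻ τ, ‖op τ x‖ₑ ^ 2 ≤ (bound * ‖x‖ₑ) ^ 2

namespace SmoothingKernel

variable {E F : Type*} [NormedAddCommGroup E] [NormedSpace ℝ E] [NormedAddCommGroup F]
  [NormedSpace ℝ F] [SecondCountableTopology F] (K : SmoothingKernel F E) {f : ℝ → F}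

theorem ae_integrable (hf : Integrable f) : ∀ᵐ t, Integrable fun s => K.op (t - s) (f s) := by
  have h_meas := aestronglyMeasurable_kernel_sub_comp K.stronglyMeasurable hf.aestronglyMeasurable
  have h_fin : ∫⁻ t, (∫⁻ s, ‖K.op (t - s) (f s)‖ₑ) ^ 2 ≠ ∞ :=
    ((lintegral_sq_lintegral_kernel_le K.stronglyMeasurable K.lintegral_le
      hf.aestronglyMeasurable).trans_lt
        (ENNReal.pow_lt_top (ENNReal.mul_lt_top ENNReal.coe_lt_top hf.hasFiniteIntegral))).ne
  filter_upwards [ae_lt_top' (h_meas.enorm.lintegral_prod_right'.pow_const 2) h_fin] with t ht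
  exact ⟨aestronglyMeasurable_kernel_comp K.stronglyMeasurable (measurable_const.sub measurable_id)
    hf.aestronglyMeasurable, (ENNReal.pow_lt_top_iff.1 ht).resolve_right two_ne_zero⟩

theorem eLpNorm_duhamel_le (hf : AEStronglyMeasurable f) :
    eLpNorm (duhamel K.op f) 2 volume ≤ K.bound * eLpNorm f 1 volume := by
  rw [eLpNorm_two_le_iff, eLpNorm_one_eq_lintegral_enorm]
  refine le_trans (lintegral_mono fun t => ?_)
    (lintegral_sq_lintegral_kernel_le K.stronglyMeasurable K.lintegral_le hf)
  gcongr
  exact enorm_integral_le_lintegral_enorm _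

theorem memLp_duhamel (hf : MemLp f 1) : MemLp (duhamel K.op f) 2 :=
  ⟨(aestronglyMeasurable_kernel_sub_comp K.stronglyMeasurable hf.1).integral_prod_right',
    (K.eLpNorm_duhamel_le hf.1).trans_lt (ENNReal.mul_lt_top ENNReal.coe_lt_top hf.2)⟩

/-- Convolution in time with the kernel, as an operator from `L¹(ℝ; F)` to `L²(ℝ; E)`. -/
def duhamelL : Lp F 1 (volume : Measure ℝ) →L[ℝ] Lp E 2 (volume : Measure ℝ) :=
  LinearMap.mkContinuous
    { toFun := fun f => (K.memLp_duhamel (Lp.memLp f)).toLp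
      map_add' := fun f g => by
        rw [← MemLp.toLp_add]
        refine MemLp.toLp_congr _ _ ?_
        rw [duhamel_congr K.op (Lp.coeFn_add f g)]
        filter_upwards [K.ae_integrable (memLp_one_iff_integrable.1 (Lp.memLp f)),
          K.ae_integrable (memLp_one_iff_integrable.1 (Lp.memLp g))] with t hf hg
        simp [duhamel, integral_add hf hg]
      map_smul' := fun c f => by
        rw [RingHom.id_apply, ← MemLp.toLp_const_smul]
        refine MemLp.toLp_congr _ _ ?_
        rw [duhamel_congr K.op (Lp.coeFn_smul c f)]
        exact Eventually.of_forall fun t => by simp [duhamel, integral_smul] }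
    K.bound (fun f => by
      rw [LinearMap.coe_mk, AddHom.coe_mk, Lp.norm_toLp, Lp.norm_def]
      have h := ENNReal.toReal_mono
        (ENNReal.mul_lt_top ENNReal.coe_lt_top (Lp.memLp f).2).ne
        (K.eLpNorm_duhamel_le (Lp.memLp f).1)
      rwa [ENNReal.toReal_mul, ENNReal.coe_toReal] at h)

theorem coeFn_duhamelL (f : Lp F 1 (volume : Measure ℝ)) :
    K.duhamelL f =ᵐ[volume] duhamel K.op f :=
  MemLp.coeFn_toLp (K.memLp_duhamel (Lp.memLp f))

theorem norm_duhamelL_le : ‖K.duhamelL‖ ≤ K.bound :=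
  LinearMap.mkContinuous_norm_le _ K.bound.2 _

end SmoothingKernel

section QuadraticEquation

variable {E : Type*} [NormedAddCommGroup E] [NormedSpace ℝ E]

theorem norm_bilinear_diagonal_sub_le (B : E →L[ℝ] E →L[ℝ] E) {r : ℝ} {v w : E} (hv : ‖v‖ ≤ r)
    (hw : ‖w‖ ≤ r) : ‖B v v - B w w‖ ≤ 2 * ‖B‖ * r * ‖v - w‖ := by
  calc ‖B v v - B w w‖ = ‖B v (v - w) + B (v - w) w‖ := by
        simp only [map_sub, sub_apply, sub_add_sub_cancel]
    _ ≤ ‖B‖ * ‖v‖ * ‖v - w‖ + ‖B‖ * ‖v - w‖ * ‖w‖ :=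
        (norm_add_le _ _).trans (add_le_add (B.le_opNorm₂ _ _) (B.le_opNorm₂ _ _))
    _ ≤ ‖B‖ * r * ‖v - w‖ + ‖B‖ * ‖v - w‖ * r := by gcongr
    _ = 2 * ‖B‖ * r * ‖v - w‖ := by ring

theorem exists_eq_add_bilinear_diagonal [CompleteSpace E] (B : E →L[ℝ] E →L[ℝ] E) {g : E}
    (hg : 4 * ‖B‖ * ‖g‖ < 1) : ∃ w, w = g + B w w := by
  set s := Metric.closedBall (0 : E) (2 * ‖g‖) with hs
  have h_maps : MapsTo (fun w => g + B w w) s s := by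
    intro w hw
    rw [hs, mem_closedBall_zero_iff] at hw ⊢
    calc ‖g + B w w‖ ≤ ‖g‖ + ‖B‖ * ‖w‖ * ‖w‖ :=
          (norm_add_le _ _).trans (by gcongr; exact B.le_opNorm₂ w w)
      _ ≤ ‖g‖ + ‖B‖ * (2 * ‖g‖) * (2 * ‖g‖) := by gcongr
      _ = ‖g‖ + (4 * ‖B‖ * ‖g‖) * ‖g‖ := by ring
      _ ≤ ‖g‖ + 1 * ‖g‖ := by gcongr
      _ = 2 * ‖g‖ := by ring
  have h_contr : ContractingWith (4 * ‖B‖ * ‖g‖).toNNReal (h_maps.restrict _ s s) := by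
    refine ⟨by rwa [Real.toNNReal_lt_one], LipschitzWith.of_dist_le_mul fun v w => ?_⟩
    rw [Real.coe_toNNReal _ (by positivity), Subtype.dist_eq, Subtype.dist_eq, dist_eq_norm,
      dist_eq_norm, MapsTo.val_restrict_apply, MapsTo.val_restrict_apply, add_sub_add_left_eq_sub]
    exact (norm_bilinear_diagonal_sub_le B (mem_closedBall_zero_iff.1 v.2)
      (mem_closedBall_zero_iff.1 w.2)).trans_eq (by ring)
  obtain ⟨w, -, hw, -⟩ := h_contr.exists_fixedPoint' Metric.isClosed_closedBall.isComplete h_maps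
    (Metric.mem_closedBall_self (by positivity)) (edist_ne_top _ _)
  exact ⟨w, hw.symm⟩

end QuadraticEquation

theorem norm_sq_eq_integral {α E : Type*} [MeasurableSpace α] {μ : Measure α}
    [NormedAddCommGroup E] (U : Lp E 2 μ) : ‖U‖ ^ 2 = ∫ x, ‖U x‖ ^ 2 ∂μ := by
  rw [Lp.norm_def, (Lp.memLp U).eLpNorm_eq_integral_rpow_norm two_ne_zero ENNReal.ofNat_ne_top,
    ENNReal.toReal_ofReal (by positivity), ← Real.rpow_natCast, ← Real.rpow_mul (by positivity)]
  simp

section Cutoff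

variable {α E F G : Type*} [MeasurableSpace α] {μ : Measure α} [NormedAddCommGroup E]
  [NormedSpace ℝ E] [NormedAddCommGroup F] [NormedSpace ℝ F] [NormedAddCommGroup G]
  [NormedSpace ℝ G] {p : ℝ≥0∞} [Fact (1 ≤ p)] {s t : Set α}

/-- Multiplication by the indicator function of the measurable set `s` on `L^p`. -/
def cutoff (s : Set α) : Lp E p μ →L[ℝ] Lp E p μ := mulLp E μ p (s.indicator (1 : α → ℝ))

theorem coeFn_cutoff (hs : MeasurableSet s) (f : Lp E p μ) : cutoff s f =ᵐ[μ] s.indicator f := by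
  have h : MemLp (s.indicator (1 : α → ℝ)) ∞ μ :=
    memLp_top_of_bound (stronglyMeasurable_one.indicator hs).aestronglyMeasurable 1
      (Eventually.of_forall fun x => (norm_indicator_le_norm_self _ _).trans_eq (by simp))
  filter_upwards [coeFn_mulLp h f] with x hx
  by_cases hxs : x ∈ s <;> simp [cutoff, hx, hxs]

theorem cutoff_cutoff (hs : MeasurableSet s) (ht : MeasurableSet t) (f : Lp E p μ) :
    cutoff s (cutoff t f) = cutoff (s ∩ t) f := by
  refine Lp.ext ?_
  filter_upwards [coeFn_cutoff hs (cutoff t f), coeFn_cutoff ht f, coeFn_cutoff (hs.inter ht) f]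
    with x h_outer h_inner h_inter
  rw [h_outer, h_inter, ← indicator_indicator]
  by_cases hx : x ∈ s <;> simp [hx, h_inner]

theorem cutoff_self_cutoff (hs : MeasurableSet s) (f : Lp E p μ) :
    cutoff s (cutoff s f) = cutoff s f := by
  rw [cutoff_cutoff hs hs, inter_self]

theorem cutoff_empty (f : Lp E p μ) : cutoff ∅ f = 0 := by
  rw [cutoff, indicator_empty']
  exact congrArg (· f) (mulLp_zero (𝕜 := ℝ))

theorem cutoff_cutoff_of_disjoint (hs : MeasurableSet s) (ht : MeasurableSet t)
    (hst : Disjoint s t) (f : Lp E p μ) : cutoff s (cutoff t f) = 0 := by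
  rw [cutoff_cutoff hs ht, hst.inter_eq, cutoff_empty]

theorem cutoff_union (hs : MeasurableSet s) (ht : MeasurableSet t) (hst : Disjoint s t)
    (f : Lp E p μ) : cutoff (s ∪ t) f = cutoff s f + cutoff t f := by
  refine Lp.ext ?_
  filter_upwards [coeFn_cutoff hs f, coeFn_cutoff ht f, coeFn_cutoff (hs.union ht) f,
    Lp.coeFn_add (cutoff s f) (cutoff t f)] with x h_left h_right h_union h_add
  rw [h_add, h_union, Pi.add_apply, h_left, h_right, indicator_union_of_disjoint hst]

theorem norm_cutoff_le (hs : MeasurableSet s) (f : Lp E p μ) : ‖cutoff s f‖ ≤ ‖f‖ := by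
  refine Lp.norm_le_norm_of_ae_le ?_
  filter_upwards [coeFn_cutoff hs f] with x hx
  rw [hx]
  exact norm_indicator_le_norm_self _ _

theorem holder_cutoff_left {p' r : ℝ≥0∞} [p.HolderTriple p' r] [Fact (1 ≤ r)]
    (q : E →L[ℝ] F →L[ℝ] G) (hs : MeasurableSet s) (U : Lp E p μ) (V : Lp F p' μ) :
    q.holder r (cutoff s U) V = cutoff s (q.holder r U V) := by
  refine Lp.ext ?_
  filter_upwards [coeFn_cutoff hs (q.holder r U V), coeFn_cutoff hs U,
    q.coeFn_holder (r := r) (cutoff s U) V, q.coeFn_holder (r := r) U V]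
    with x h_cut hU h_left h_right
  rw [h_left, h_cut, hU]
  by_cases hx : x ∈ s <;> simp [hx, h_right]

theorem holder_cutoff_right {p' r : ℝ≥0∞} [p'.HolderTriple p r] [Fact (1 ≤ r)]
    (q : E →L[ℝ] F →L[ℝ] G) (hs : MeasurableSet s) (U : Lp E p' μ) (V : Lp F p μ) :
    q.holder r U (cutoff s V) = cutoff s (q.holder r U V) := by
  refine Lp.ext ?_
  filter_upwards [coeFn_cutoff hs (q.holder r U V), coeFn_cutoff hs V,
    q.coeFn_holder (r := r) U (cutoff s V), q.coeFn_holder (r := r) U V]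
    with x h_cut hV h_left h_right
  rw [h_left, h_cut, hV]
  by_cases hx : x ∈ s <;> simp [hx, h_right]

theorem holder_cutoff_cutoff {p' r : ℝ≥0∞} [p.HolderTriple p' r] [Fact (1 ≤ p')] [Fact (1 ≤ r)]
    (q : E →L[ℝ] F →L[ℝ] G)
    (hs : MeasurableSet s) (U : Lp E p μ) (V : Lp F p' μ) :
    q.holder r (cutoff s U) (cutoff s V) = cutoff s (q.holder r U V) := by
  rw [holder_cutoff_left q hs, holder_cutoff_right q hs, cutoff_self_cutoff hs]

theorem norm_cutoff_sq (hs : MeasurableSet s) (U : Lp E 2 μ) :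
    ‖cutoff s U‖ ^ 2 = ∫ x in s, ‖U x‖ ^ 2 ∂μ := by
  rw [norm_sq_eq_integral, ← integral_indicator hs]
  refine integral_congr_ae ?_
  filter_upwards [coeFn_cutoff hs U] with x hx
  by_cases hxs : x ∈ s <;> simp [hx, hxs]

theorem cutoff_Ioc_add {μ : Measure ℝ} {a b c : ℝ} (hab : a ≤ b) (hbc : b ≤ c) (f : Lp E p μ) :
    cutoff (Ioc a b) f + cutoff (Ioc b c) f = cutoff (Ioc a c) f := by
  rw [← Ioc_union_Ioc_eq_Ioc hab hbc,
    cutoff_union measurableSet_Ioc measurableSet_Ioc (Ioc_disjoint_Ioc_of_le le_rfl)]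

theorem continuous_norm_cutoff_Ioc {μ : Measure ℝ} [NullSingletonClass μ] (U : Lp E 2 μ) (a : ℝ) :
    Continuous fun b => ‖cutoff (Ioc a b) U‖ := by
  have h_primitive : Continuous fun b => ∫ r in a..b, ‖U r‖ ^ 2 ∂μ :=
    intervalIntegral.continuous_primitive
      (fun _ _ => ((Lp.memLp U).integrable_norm_pow two_ne_zero).intervalIntegrable) a
  have h_norm : ∀ b, ‖cutoff (Ioc a b) U‖ = √(∫ r in a..max a b, ‖U r‖ ^ 2 ∂μ) := fun b => by
    rw [intervalIntegral.integral_of_le (le_max_left a b), ← norm_cutoff_sq measurableSet_Ioc,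
      Real.sqrt_sq (norm_nonneg _)]
    rcases le_total a b with h | h
    · rw [max_eq_right h]
    · rw [max_eq_left h, Ioc_eq_empty_of_le h, Ioc_self]
  simp only [h_norm]
  exact (h_primitive.comp (continuous_const.max continuous_id)).sqrt

theorem eventually_norm_cutoff_Ioc_lt {μ : Measure ℝ} [NullSingletonClass μ] (U : Lp E 2 μ) (a : ℝ)
    {ε : ℝ} (hε : 0 < ε) : ∀ᶠ b in 𝓝 a, ‖cutoff (Ioc a b) U‖ < ε :=
  (continuous_norm_cutoff_Ioc U a).continuousAt.eventually_lt_const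
    (by simpa only [Ioc_self, cutoff_empty, norm_zero] using hε)

end Cutoff

section Causal

variable {E F : Type*} [NormedAddCommGroup E] [NormedSpace ℝ E] [NormedAddCommGroup F]
  [NormedSpace ℝ F] {p p' : ℝ≥0∞} [Fact (1 ≤ p)] [Fact (1 ≤ p')]

/-- The values of `D f` up to any time `T` depend only on those of `f` up to `T`. -/
def IsCausal (D : Lp F p (volume : Measure ℝ) →L[ℝ] Lp E p' (volume : Measure ℝ)) : Prop :=
  ∀ T f, cutoff (Iic T) (D (cutoff (Iic T) f)) = cutoff (Iic T) (D f)

theorem IsCausal.cutoff_congr {D : Lp F p (volume : Measure ℝ) →L[ℝ] Lp E p' (volume : Measure ℝ)}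
    (hD : IsCausal D) {s : Set ℝ} (hs : MeasurableSet s) {T : ℝ} (hsT : s ⊆ Iic T)
    {f g : Lp F p (volume : Measure ℝ)} (hfg : cutoff (Iic T) f = cutoff (Iic T) g) :
    cutoff s (D f) = cutoff s (D g) := by
  have h : cutoff (Iic T) (D f) = cutoff (Iic T) (D g) := by rw [← hD, hfg, hD]
  simpa only [cutoff_cutoff hs measurableSet_Iic, inter_eq_self_of_subset_left hsT]
    using congrArg (cutoff s) h

theorem SmoothingKernel.isCausal_duhamelL [SecondCountableTopology F] (K : SmoothingKernel F E) :
    IsCausal K.duhamelL := by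
  intro T f
  refine Lp.ext ?_
  filter_upwards [coeFn_cutoff measurableSet_Iic (K.duhamelL (cutoff (Iic T) f)),
    coeFn_cutoff measurableSet_Iic (K.duhamelL f), K.coeFn_duhamelL f,
    K.coeFn_duhamelL (cutoff (Iic T) f)] with t h_left h_right hf h_cut
  rw [h_left, h_right]
  by_cases ht : t ∈ Iic T
  · rw [indicator_of_mem ht, indicator_of_mem ht, hf, h_cut]
    refine integral_congr_ae ?_
    filter_upwards [coeFn_cutoff measurableSet_Iic f] with s hs
    rw [hs]
    rcases le_or_gt s T with hsT | hTs
    · rw [indicator_of_mem (mem_Iic.2 hsT)]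
    · rw [K.causal _ (sub_nonpos.2 (le_trans ht hTs.le)), zero_apply, zero_apply]
  · rw [indicator_of_notMem ht, indicator_of_notMem ht]

end Causal

section LocalSolution

variable {E F : Type*} [NormedAddCommGroup E] [NormedSpace ℝ E] [NormedAddCommGroup F]
  [NormedSpace ℝ F] {D : Lp F 1 (volume : Measure ℝ) →L[ℝ] Lp E 2 (volume : Measure ℝ)}
  {q : E →L[ℝ] E →L[ℝ] F} {g U V W : Lp E 2 (volume : Measure ℝ)} {T T' a b : ℝ}

/-- `U` solves `U = g + D q(U,U)` on the time interval `(0,T]` and vanishes elsewhere. -/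
def SolvesUpTo (D : Lp F 1 (volume : Measure ℝ) →L[ℝ] Lp E 2 (volume : Measure ℝ))
    (q : E →L[ℝ] E →L[ℝ] F) (g : Lp E 2 (volume : Measure ℝ)) (T : ℝ)
    (U : Lp E 2 (volume : Measure ℝ)) : Prop :=
  U = cutoff (Ioc 0 T) (g + D (q.holder 1 U U))

theorem solvesUpTo_zero : SolvesUpTo D q g 0 0 := by
  rw [SolvesUpTo, Ioc_self, cutoff_empty]

theorem SolvesUpTo.cutoff_eq (hU : SolvesUpTo D q g T U) : cutoff (Ioc 0 T) U = U := by
  conv_lhs => rw [hU]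
  rw [cutoff_self_cutoff measurableSet_Ioc]
  exact hU.symm

theorem norm_map_holder_le (U V : Lp E 2 (volume : Measure ℝ)) :
    ‖D (q.holder 1 U V)‖ ≤ ‖D‖ * ‖q‖ * ‖U‖ * ‖V‖ :=
  calc ‖D (q.holder 1 U V)‖ ≤ ‖D‖ * (‖q‖ * ‖U‖ * ‖V‖) :=
        D.le_opNorm_of_le (q.norm_holder_apply_apply_le U V)
    _ = ‖D‖ * ‖q‖ * ‖U‖ * ‖V‖ := by ring

theorem exists_eq_cutoff [CompleteSpace E] {s : Set ℝ} (hs : MeasurableSet s)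
    (hg : 4 * (‖D‖ * ‖q‖) * ‖cutoff s g‖ < 1) :
    ∃ W, W = cutoff s (g + D (q.holder 1 W W)) := by
  let B : Lp E 2 (volume : Measure ℝ) →L[ℝ] Lp E 2 (volume : Measure ℝ) →L[ℝ]
      Lp E 2 (volume : Measure ℝ) :=
    (ContinuousLinearMap.compL ℝ _ _ _ (cutoff s ∘L D)) ∘L q.holderL volume 2 2 1
  have hB : ‖B‖ ≤ ‖D‖ * ‖q‖ := B.opNorm_le_bound₂ (by positivity) fun U V =>
    (norm_cutoff_le hs _).trans (norm_map_holder_le U V)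
  obtain ⟨W, hW⟩ := exists_eq_add_bilinear_diagonal B (g := cutoff s g) (lt_of_le_of_lt
    (by gcongr) hg)
  exact ⟨W, by rw [map_add]; exact hW⟩

theorem exists_solvesUpTo_of_small [CompleteSpace E] (hg : 4 * (‖D‖ * ‖q‖) * ‖g‖ < 1) (T : ℝ) :
    ∃ U, SolvesUpTo D q g T U :=
  exists_eq_cutoff measurableSet_Ioc <| lt_of_le_of_lt
    (mul_le_mul_of_nonneg_left (norm_cutoff_le measurableSet_Ioc g) (by positivity)) hg

theorem SolvesUpTo.restrict (hD : IsCausal D) (hU : SolvesUpTo D q g T' U) (hT : T ≤ T') :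
    SolvesUpTo D q g T (cutoff (Ioc 0 T) U) := by
  have hU_cut : cutoff (Ioc 0 T) U = cutoff (Ioc 0 T) (g + D (q.holder 1 U U)) := by
    conv_lhs => rw [hU]
    rw [cutoff_cutoff measurableSet_Ioc measurableSet_Ioc, inter_eq_self_of_subset_left
      (Ioc_subset_Ioc_right hT)]
  have h_sets : Iic T ∩ Ioc 0 T' = Iic T ∩ (Ioc 0 T ∩ Ioc 0 T') := by
    ext x
    simp only [mem_inter_iff, mem_Iic, mem_Ioc]
    tauto
  have hUU : cutoff (Iic T) (q.holder 1 U U) =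
      cutoff (Iic T) (cutoff (Ioc 0 T) (q.holder 1 U U)) := by
    rw [← hU.cutoff_eq, holder_cutoff_cutoff q measurableSet_Ioc,
      cutoff_cutoff measurableSet_Ioc measurableSet_Ioc,
      cutoff_cutoff measurableSet_Iic measurableSet_Ioc,
      cutoff_cutoff measurableSet_Iic (measurableSet_Ioc.inter measurableSet_Ioc), h_sets]
  rw [SolvesUpTo, holder_cutoff_cutoff q measurableSet_Ioc, hU_cut, map_add, map_add,
    hD.cutoff_congr measurableSet_Ioc Ioc_subset_Iic_self hUU]

theorem holder_eq_zero_of_cutoff_disjoint {s t : Set ℝ} (hs : MeasurableSet s)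
    (ht : MeasurableSet t) (hst : Disjoint s t) (hU : cutoff s U = U) (hV : cutoff t V = V) :
    q.holder 1 U V = 0 := by
  rw [← hU, ← hV, holder_cutoff_left q hs, holder_cutoff_right q ht,
    cutoff_cutoff_of_disjoint hs ht hst]

theorem SolvesUpTo.add (hD : IsCausal D) (hT : 0 ≤ T) (hTT : T ≤ T') (hU : SolvesUpTo D q g T U)
    (hW : W = cutoff (Ioc T T') (g + D (q.holder 1 U U) + D (q.holder 1 W W))) :
    SolvesUpTo D q g T' (U + W) := by
  have hW_cut : cutoff (Ioc T T') W = W := by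
    conv_lhs => rw [hW]
    rw [cutoff_self_cutoff measurableSet_Ioc]
    exact hW.symm
  have h_disj : Disjoint (Ioc 0 T) (Ioc T T') := Ioc_disjoint_Ioc_of_le le_rfl
  have hUW : q.holder 1 U W = 0 := holder_eq_zero_of_cutoff_disjoint measurableSet_Ioc
    measurableSet_Ioc h_disj hU.cutoff_eq hW_cut
  have hWU : q.holder 1 W U = 0 := holder_eq_zero_of_cutoff_disjoint measurableSet_Ioc
    measurableSet_Ioc h_disj.symm hW_cut hU.cutoff_eq
  have hWW : cutoff (Iic T) (q.holder 1 W W) = cutoff (Iic T) 0 := by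
    rw [← hW_cut, holder_cutoff_cutoff q measurableSet_Ioc, map_zero,
      cutoff_cutoff_of_disjoint measurableSet_Iic measurableSet_Ioc (Iic_disjoint_Ioc le_rfl)]
  have hDWW : cutoff (Ioc 0 T) (D (q.holder 1 W W)) = 0 := by
    rw [hD.cutoff_congr measurableSet_Ioc Ioc_subset_Iic_self hWW, map_zero, map_zero]
  rw [SolvesUpTo, q.holder_add_left, q.holder_add_right, q.holder_add_right, hUW, hWU, add_zero,
    zero_add, map_add D, ← add_assoc, ← cutoff_Ioc_add hT hTT, ← hW, map_add, hDWW, add_zero]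
  exact congrArg (· + W) hU

theorem SolvesUpTo.exists_extension [CompleteSpace E] (hD : IsCausal D) (hT : 0 ≤ T)
    (hU : SolvesUpTo D q g T U) : ∃ T' > T, ∃ U', SolvesUpTo D q g T' U' := by
  obtain ⟨T', h_small, hTT⟩ := ((eventually_norm_cutoff_Ioc_lt (g + D (q.holder 1 U U)) T
    (ε := 1 / (4 * (‖D‖ * ‖q‖) + 1)) (by positivity)).filter_mono nhdsWithin_le_nhds
      |>.and (self_mem_nhdsWithin (s := Ioi T))).exists
  rw [lt_div_iff₀ (by positivity)] at h_small
  obtain ⟨W, hW⟩ := exists_eq_cutoff (q := q) measurableSet_Ioc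
    (show 4 * (‖D‖ * ‖q‖) * ‖cutoff (Ioc T T') (g + D (q.holder 1 U U))‖ < 1 by
      nlinarith [norm_nonneg (cutoff (Ioc T T') (g + D (q.holder 1 U U)))])
  exact ⟨T', hTT, U + W, hU.add hD hT (le_of_lt hTT) hW⟩

theorem SolvesUpTo.sub_eq (hU : SolvesUpTo D q g T U) (hV : SolvesUpTo D q g T V) :
    U - V = cutoff (Ioc 0 T) (D (q.holder 1 U (U - V) + q.holder 1 (U - V) V)) := by
  have h : q.holder 1 U (U - V) + q.holder 1 (U - V) V = q.holder 1 U U - q.holder 1 V V := by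
    simp only [← q.holderL_apply_apply volume 2 2 1, map_sub, sub_apply, sub_add_sub_cancel]
  rw [h, map_sub, map_sub]
  conv_lhs => rw [hU, hV]
  rw [map_add, map_add, add_sub_add_left_eq_sub]

theorem cutoff_Ioc_eq_zero_of_small (hD : IsCausal D)
    (hW : W = cutoff (Ioc 0 T) (D (q.holder 1 U W + q.holder 1 W V)))
    (ha : 0 ≤ a) (hab : a ≤ b) (hbT : b ≤ T) (hWa : cutoff (Ioc 0 a) W = 0)
    (h_small : ‖D‖ * ‖q‖ * (‖cutoff (Ioc a b) U‖ + ‖cutoff (Ioc a b) V‖) < 1) :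
    cutoff (Ioc 0 b) W = 0 := by
  have h_Ioc : MeasurableSet (Ioc a b) := measurableSet_Ioc
  have hWb : cutoff (Ioc 0 b) W = cutoff (Ioc a b) W := by
    rw [← cutoff_Ioc_add ha hab, hWa, zero_add]
  set R := cutoff (Ioc a b) W with hR
  have hR_cut : cutoff (Ioc a b) R = R := cutoff_self_cutoff h_Ioc W
  have hW_Iic : cutoff (Iic b) W = R := by
    have hW_cut : cutoff (Ioc 0 T) W = W := by
      conv_lhs => rw [hW]
      rw [cutoff_self_cutoff measurableSet_Ioc]
      exact hW.symm
    rw [← hWb, ← hW_cut, cutoff_cutoff measurableSet_Iic measurableSet_Ioc,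
      cutoff_cutoff measurableSet_Ioc measurableSet_Ioc]
    congr 2
    ext x
    simp only [mem_inter_iff, mem_Iic, mem_Ioc]
    tauto
  have h_eq : R = cutoff (Ioc a b) (D (q.holder 1 (cutoff (Ioc a b) U) R +
      q.holder 1 R (cutoff (Ioc a b) V))) := by
    conv_lhs => rw [hR, hW, cutoff_cutoff h_Ioc measurableSet_Ioc,
      inter_eq_self_of_subset_left (Ioc_subset_Ioc ha hbT)]
    refine hD.cutoff_congr h_Ioc Ioc_subset_Iic_self ?_
    rw [holder_cutoff_left q h_Ioc, ← holder_cutoff_right q h_Ioc, holder_cutoff_right q h_Ioc R,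
      ← holder_cutoff_left q h_Ioc R, hR_cut, ← hW_Iic, holder_cutoff_left q measurableSet_Iic,
      holder_cutoff_right q measurableSet_Iic, ← map_add, cutoff_self_cutoff measurableSet_Iic]
  have h_le : ‖R‖ ≤ ‖D‖ * ‖q‖ * (‖cutoff (Ioc a b) U‖ + ‖cutoff (Ioc a b) V‖) * ‖R‖ := by
    conv_lhs => rw [h_eq]
    refine (norm_cutoff_le h_Ioc _).trans ?_
    rw [map_add]
    exact ((norm_add_le _ _).trans (add_le_add (norm_map_holder_le _ _)
      (norm_map_holder_le _ _))).trans_eq (by ring)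
  rw [hWb, ← norm_eq_zero]
  nlinarith [norm_nonneg R]

theorem SolvesUpTo.unique (hD : IsCausal D) (hT : 0 ≤ T) (hU : SolvesUpTo D q g T U)
    (hV : SolvesUpTo D q g T V) : U = V := by
  have h_closed : IsClosed {t | cutoff (Ioc 0 t) (U - V) = 0} := by
    simpa only [norm_eq_zero] using
      isClosed_eq (continuous_norm_cutoff_Ioc (U - V) 0) (continuous_const (y := (0 : ℝ)))
  have h_subset : Icc 0 T ⊆ {t | cutoff (Ioc 0 t) (U - V) = 0} := by
    refine (h_closed.inter isClosed_Icc).Icc_subset_of_forall_exists_gt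
      (by rw [mem_ofPred_eq, Ioc_self, cutoff_empty]) ?_
    rintro a ⟨hWa, ha0, haT⟩ c hac
    have hε : 0 < 1 / (2 * (‖D‖ * ‖q‖) + 1) := by positivity
    obtain ⟨b, ⟨⟨hbU, hbV⟩, hbc⟩, hab, hbT⟩ := ((((eventually_norm_cutoff_Ioc_lt U a hε).and
      (eventually_norm_cutoff_Ioc_lt V a hε)).filter_mono nhdsWithin_le_nhds |>.and
        (Ioc_mem_nhdsGT hac)).and (Ioc_mem_nhdsGT haT)).exists
    refine ⟨b, cutoff_Ioc_eq_zero_of_small hD (hU.sub_eq hV) ha0 hab.le hbT hWa ?_, hbc⟩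
    rw [lt_div_iff₀ (by positivity)] at hbU hbV
    nlinarith [norm_nonneg (cutoff (Ioc a b) U), norm_nonneg (cutoff (Ioc a b) V)]
  have h := h_subset (right_mem_Icc.2 hT)
  rw [mem_ofPred_eq, map_sub, hU.cutoff_eq, hV.cutoff_eq] at h
  exact sub_eq_zero.1 h

end LocalSolution

theorem tendsto_mulLp {α 𝕜 E ι : Type*} [MeasurableSpace α] {μ : Measure α} [NormedField 𝕜]
    [NormedAlgebra ℝ 𝕜] [NormedAddCommGroup E] [NormedSpace ℝ E] [NormedSpace 𝕜 E]
    [IsScalarTower ℝ 𝕜 E] {l : Filter ι} [l.IsCountablyGenerated] {σ : ι → α → 𝕜} {σ' : α → 𝕜}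
    (hσ : ∀ i, MemLp (σ i) ∞ μ) (hσ' : MemLp σ' ∞ μ) {C : ℝ} (hC : ∀ᶠ i in l, ∀ x, ‖σ i x‖ ≤ C)
    (hC' : ∀ x, ‖σ' x‖ ≤ C) (h : ∀ x, Tendsto (fun i => σ i x) l (𝓝 (σ' x))) (f : Lp E 1 μ) :
    Tendsto (fun i => mulLp E μ 1 (σ i) f) l (𝓝 (mulLp E μ 1 σ' f)) := by
  have h_norm : ∀ i, ‖mulLp E μ 1 (σ i) f - mulLp E μ 1 σ' f‖ =
      ∫ x, ‖(σ i x - σ' x) • f x‖ ∂μ := by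
    intro i
    rw [L1.norm_eq_integral_norm]
    refine integral_congr_ae ?_
    filter_upwards [Lp.coeFn_sub (mulLp E μ 1 (σ i) f) (mulLp E μ 1 σ' f), coeFn_mulLp (hσ i) f,
      coeFn_mulLp hσ' f] with x h_sub hx hx'
    rw [h_sub, Pi.sub_apply, hx, hx', sub_smul]
  rw [tendsto_iff_norm_sub_tendsto_zero]
  simp only [h_norm]
  rw [← integral_zero α ℝ (μ := μ)]
  refine tendsto_integral_filter_of_dominated_convergence (fun x => (C + C) * ‖f x‖)
    (Eventually.of_forall fun i => (((hσ i).1.sub hσ'.1).smul (Lp.aestronglyMeasurable f)).norm)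
    ?_ ((L1.integrable_coeFn f).norm.const_mul _) (Eventually.of_forall fun x => ?_)
  · filter_upwards [hC] with i hi
    refine Eventually.of_forall fun x => ?_
    rw [norm_norm, norm_smul]
    gcongr
    exact (norm_sub_le _ _).trans (add_le_add (hi x) (hC' x))
  · simpa only [sub_self, zero_smul, norm_zero] using
      (((h x).sub_const (σ' x)).smul_const (f x)).norm

/-- The space `L¹(ℝ³; E)`, in which the weighted Fourier transforms `|ξ|^i û` of the solutions
live. -/
abbrev FourierL1 (E : Type*) [NormedAddCommGroup E] : Type _ := Lp E 1 (volume : Measure R3)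

instance {E : Type*} [NormedAddCommGroup E] [TopologicalSpace.SeparableSpace E] :
    SecondCountableTopology (FourierL1 E) :=
  haveI : Fact ((1 : ℝ≥0∞) ≠ ∞) := ⟨ENNReal.one_ne_top⟩
  Lp.SecondCountableTopology

section Gauss

/-- The symbol of the heat semigroup `e^{τΔ}`. -/
def gauss (τ : ℝ) (ξ : R3) : ℝ := Real.exp (-τ * (2 * Real.pi * ‖ξ‖) ^ 2)

theorem gauss_pos (τ : ℝ) (ξ : R3) : 0 < gauss τ ξ := Real.exp_pos _

theorem gauss_le_one {τ : ℝ} (hτ : 0 ≤ τ) (ξ : R3) : gauss τ ξ ≤ 1 := by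
  rw [gauss, Real.exp_le_one_iff, neg_mul, neg_nonpos]
  positivity

theorem continuous_gauss : Continuous fun z : ℝ × R3 => gauss z.1 z.2 := by
  unfold gauss
  fun_prop

theorem norm_sq_mul_gauss_le {τ : ℝ} (hτ : 0 < τ) (ξ : R3) : ‖ξ‖ ^ 2 * gauss τ ξ ≤ 1 / τ := by
  have h_exp := Real.add_one_le_exp (τ * (2 * Real.pi * ‖ξ‖) ^ 2)
  have h_pi : τ * ‖ξ‖ ^ 2 ≤ τ * (2 * Real.pi * ‖ξ‖) ^ 2 := by
    gcongr
    nlinarith [Real.pi_gt_three, norm_nonneg ξ]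
  rw [gauss, neg_mul, Real.exp_neg, ← div_eq_mul_inv, div_le_div_iff₀ (Real.exp_pos _) hτ]
  linarith

theorem pow_le_one_add_sq {x : ℝ} (hx : 0 ≤ x) {p : ℕ} (hp : p ≤ 2) : x ^ p ≤ 1 + x ^ 2 := by
  rcases le_total x 1 with h | h
  · linarith [pow_le_one₀ hx h (n := p), sq_nonneg x]
  · linarith [pow_le_pow_right₀ h hp]

theorem norm_pow_mul_gauss_le {τ : ℝ} (hτ : 0 < τ) {p : ℕ} (hp : p ≤ 2) (ξ : R3) :
    ‖ξ‖ ^ p * gauss τ ξ ≤ 1 + 1 / τ := by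
  calc ‖ξ‖ ^ p * gauss τ ξ ≤ (1 + ‖ξ‖ ^ 2) * gauss τ ξ :=
        mul_le_mul_of_nonneg_right (pow_le_one_add_sq (norm_nonneg ξ) hp) (gauss_pos _ _).le
    _ = gauss τ ξ + ‖ξ‖ ^ 2 * gauss τ ξ := by ring
    _ ≤ 1 + 1 / τ := add_le_add (gauss_le_one hτ.le ξ) (norm_sq_mul_gauss_le hτ ξ)

end Gauss

section HeatSymbol

/-- The symbol `|ξ|^p e^{-ντ(2π|ξ|)²}` of `|∇|^p e^{ντΔ}` up to a constant, extended by `0` to the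
times `τ ≤ 0`. -/
def heatSymbol (ν : ℝ) (p : ℕ) (τ : ℝ) (ξ : R3) : ℝ :=
  (Ioi 0).indicator (fun τ => ‖ξ‖ ^ p * gauss (ν * τ) ξ) τ

variable {ν τ : ℝ} {p : ℕ}

theorem heatSymbol_of_pos (hτ : 0 < τ) (ξ : R3) :
    heatSymbol ν p τ ξ = ‖ξ‖ ^ p * gauss (ν * τ) ξ := indicator_of_mem hτ _

theorem heatSymbol_of_nonpos (hτ : τ ≤ 0) : heatSymbol ν p τ = 0 :=
  funext fun _ => indicator_of_notMem (notMem_Ioi.2 hτ) _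

theorem norm_heatSymbol_of_pos (hτ : 0 < τ) (ξ : R3) :
    ‖heatSymbol ν p τ ξ‖ = ‖ξ‖ ^ p * gauss (ν * τ) ξ := by
  rw [heatSymbol_of_pos hτ, Real.norm_of_nonneg (mul_nonneg (by positivity) (gauss_pos _ _).le)]

theorem measurable_heatSymbol : Measurable fun z : ℝ × R3 => heatSymbol ν p z.1 z.2 := by
  have h_cont : Continuous fun z : ℝ × R3 => ‖z.2‖ ^ p * gauss (ν * z.1) z.2 :=
    (continuous_snd.norm.pow p).mul
      (continuous_gauss.comp (by fun_prop : Continuous fun z : ℝ × R3 => (ν * z.1, z.2)))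
  exact h_cont.measurable.indicator (measurable_fst measurableSet_Ioi)

theorem norm_heatSymbol_le (hν : 0 < ν) (hp : p ≤ 2) {τ₀ : ℝ} (hτ₀ : 0 < τ₀) (hτ : τ₀ ≤ τ)
    (ξ : R3) : ‖heatSymbol ν p τ ξ‖ ≤ 1 + 1 / (ν * τ₀) := by
  rw [norm_heatSymbol_of_pos (hτ₀.trans_le hτ)]
  refine (norm_pow_mul_gauss_le (mul_pos hν (hτ₀.trans_le hτ)) hp ξ).trans ?_
  gcongr

theorem memLp_heatSymbol (hν : 0 < ν) (hp : p ≤ 2) (τ : ℝ) : MemLp (heatSymbol ν p τ) ∞ := by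
  rcases le_or_gt τ 0 with hτ | hτ
  · rw [heatSymbol_of_nonpos hτ]
    exact MemLp.zero
  · exact memLp_top_of_bound
      (measurable_heatSymbol.comp measurable_prodMk_left).aestronglyMeasurable (1 + 1 / (ν * τ))
      (Eventually.of_forall (norm_heatSymbol_le hν hp hτ le_rfl))

theorem lintegral_mul_exp_le {b x : ℝ} (hb : 0 < b) (hx : 0 ≤ x) :
    ∫⁻ τ in Ioi (0 : ℝ), ENNReal.ofReal (x * Real.exp (-(b * x) * τ)) ≤
      ENNReal.ofReal (1 / b) := by
  rcases hx.eq_or_lt with rfl | hx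
  · simp
  have hbx : -(b * x) < 0 := neg_neg_of_pos (mul_pos hb hx)
  rw [← ofReal_integral_eq_lintegral_ofReal ((integrableOn_exp_mul_Ioi hbx 0).const_mul x)
    (Eventually.of_forall fun τ => by positivity), integral_const_mul, integral_exp_mul_Ioi hbx]
  refine ENNReal.ofReal_le_ofReal (le_of_eq ?_)
  rw [mul_zero, Real.exp_zero]
  field_simp

theorem lintegral_heatSymbol_pow_le (hν : 0 < ν) {k : ℕ} (hk : k ≠ 0) (hpk : p * k = 2) (ξ : R3) :
    ∫⁻ τ, ‖heatSymbol ν p τ ξ‖ₑ ^ k ≤ ENNReal.ofReal (1 / (4 * k * Real.pi ^ 2 * ν)) := by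
  have h_support : ∀ τ ∉ Ioi (0 : ℝ), ‖heatSymbol ν p τ ξ‖ₑ ^ k = 0 := fun τ hτ => by
    rw [heatSymbol_of_nonpos (notMem_Ioi.1 hτ), Pi.zero_apply, enorm_zero, zero_pow hk]
  have h_exp : ∀ τ ∈ Ioi (0 : ℝ), ‖heatSymbol ν p τ ξ‖ₑ ^ k =
      ENNReal.ofReal (‖ξ‖ ^ 2 * Real.exp (-(4 * k * Real.pi ^ 2 * ν * ‖ξ‖ ^ 2) * τ)) := by
    intro τ hτ
    rw [← ofReal_norm, ← ENNReal.ofReal_pow (norm_nonneg _), norm_heatSymbol_of_pos hτ, mul_pow,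
      ← pow_mul, hpk, gauss, ← Real.exp_nat_mul]
    ring_nf
  rw [← setLIntegral_eq_of_support_subset (fun τ hτ => by_contra fun h => hτ (h_support τ h)),
    setLIntegral_congr_fun measurableSet_Ioi h_exp]
  exact lintegral_mul_exp_le (by positivity) (sq_nonneg _)

theorem aemeasurable_heatSymbol_mul {E : Type*} [NormedAddCommGroup E]
    (f : FourierL1 E) :
    AEMeasurable (Function.uncurry fun (τ : ℝ) (ξ : R3) => ‖heatSymbol ν p τ ξ‖ₑ * ‖f ξ‖ₑ)
      (volume.prod volume) :=
  measurable_heatSymbol.enorm.aemeasurable.mul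
    ((Lp.aestronglyMeasurable f).enorm.comp_quasiMeasurePreserving
      Measure.quasiMeasurePreserving_snd)

end HeatSymbol

section KernelOp

variable {E : Type*} [NormedAddCommGroup E] [NormedSpace ℝ E] {ν τ : ℝ} {p : ℕ}

/-- The Fourier multiplier with symbol `heatSymbol ν p τ`, acting on Fourier transforms. -/
def kernelOp (ν : ℝ) (p : ℕ) (τ : ℝ) : FourierL1 E →L[ℝ] FourierL1 E :=
  mulLp E volume 1 (heatSymbol ν p τ)

theorem kernelOp_of_nonpos (hτ : τ ≤ 0) :
    (kernelOp ν p τ : FourierL1 E →L[ℝ] FourierL1 E) = 0 := by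
  rw [kernelOp, heatSymbol_of_nonpos hτ, mulLp_zero]

theorem coeFn_kernelOp (hν : 0 < ν) (hp : p ≤ 2) (τ : ℝ) (f : FourierL1 E) :
    kernelOp ν p τ f =ᵐ[volume] fun ξ => heatSymbol ν p τ ξ • f ξ :=
  coeFn_mulLp (memLp_heatSymbol hν hp τ) f

theorem enorm_kernelOp (hν : 0 < ν) (hp : p ≤ 2) (τ : ℝ) (f : FourierL1 E) :
    ‖kernelOp ν p τ f‖ₑ = ∫⁻ ξ, ‖heatSymbol ν p τ ξ‖ₑ * ‖f ξ‖ₑ := by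
  rw [Lp.enorm_def, eLpNorm_one_eq_lintegral_enorm]
  refine lintegral_congr_ae ?_
  filter_upwards [coeFn_kernelOp hν hp τ f] with ξ hξ
  rw [hξ, enorm_smul]

theorem continuousAt_kernelOp (hν : 0 < ν) (hp : p ≤ 2) (f : FourierL1 E) (hτ : 0 < τ) :
    ContinuousAt (fun τ => kernelOp ν p τ f) τ := by
  refine tendsto_mulLp (memLp_heatSymbol hν hp) (memLp_heatSymbol hν hp τ)
    (C := 1 + 1 / (ν * (τ / 2))) ?_
    (norm_heatSymbol_le hν hp (half_pos hτ) (half_lt_self hτ).le) (fun ξ => ?_) f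
  · filter_upwards [lt_mem_nhds (half_lt_self hτ)] with r hr
    exact norm_heatSymbol_le hν hp (half_pos hτ) hr.le
  · have h_cont : Continuous fun r : ℝ => ‖ξ‖ ^ p * gauss (ν * r) ξ :=
      continuous_const.mul
        (continuous_gauss.comp (by fun_prop : Continuous fun r : ℝ => (ν * r, ξ)))
    rw [heatSymbol_of_pos hτ]
    refine (h_cont.tendsto τ).congr' ?_
    filter_upwards [lt_mem_nhds hτ] with r hr
    rw [heatSymbol_of_pos hr]

theorem stronglyMeasurable_kernelOp [TopologicalSpace.SeparableSpace E] (hν : 0 < ν) (hp : p ≤ 2)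
    (f : FourierL1 E) : StronglyMeasurable fun τ => kernelOp ν p τ f := by
  classical
  borelize (FourierL1 E)
  have h_piecewise : (fun τ => kernelOp ν p τ f) =
      (Ioi (0 : ℝ)).piecewise (fun τ => kernelOp ν p τ f) (fun _ => 0) := by
    ext1 τ
    by_cases hτ : τ ∈ Ioi (0 : ℝ)
    · rw [piecewise_eq_of_mem _ _ _ hτ]
    · rw [piecewise_eq_of_notMem _ _ _ hτ, kernelOp_of_nonpos (notMem_Ioi.1 hτ), zero_apply]
  rw [h_piecewise]
  exact (ContinuousOn.measurable_piecewise
    (fun τ hτ => (continuousAt_kernelOp hν hp f hτ).continuousWithinAt) continuousOn_const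
      measurableSet_Ioi).stronglyMeasurable

theorem lintegral_sq_kernelOp_one_le (hν : 0 < ν) (f : FourierL1 E) :
    ∫⁻ τ, ‖kernelOp ν 1 τ f‖ₑ ^ 2 ≤
      (((√(1 / (8 * Real.pi ^ 2 * ν))).toNNReal : ℝ≥0∞) * ‖f‖ₑ) ^ 2 := by
  have h_bound : ENNReal.ofReal (1 / (8 * Real.pi ^ 2 * ν)) =
      ((√(1 / (8 * Real.pi ^ 2 * ν))).toNNReal : ℝ≥0∞) ^ 2 := by
    rw [← ENNReal.ofReal, ← ENNReal.ofReal_pow (Real.sqrt_nonneg _),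
      Real.sq_sqrt (by positivity)]
  simp only [enorm_kernelOp hν one_le_two]
  rw [Lp.enorm_def f, eLpNorm_one_eq_lintegral_enorm,
    ← lintegral_const_mul'' _ (Lp.aestronglyMeasurable f).enorm]
  refine lintegral_sq_lintegral_le (aemeasurable_heatSymbol_mul f)
    ((Lp.aestronglyMeasurable f).enorm.const_mul _) (Eventually.of_forall fun ξ => ?_)
  simp only [mul_pow]
  rw [lintegral_mul_const' _ _ (ENNReal.pow_ne_top enorm_ne_top), ← h_bound]
  gcongr
  exact (lintegral_heatSymbol_pow_le hν two_ne_zero (one_mul 2) ξ).trans_eq (by norm_num)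

theorem lintegral_kernelOp_two_le (hν : 0 < ν) (f : FourierL1 E) :
    ∫⁻ τ, ‖kernelOp ν 2 τ f‖ₑ ≤ ENNReal.ofReal (1 / (4 * Real.pi ^ 2 * ν)) * ‖f‖ₑ := by
  simp only [enorm_kernelOp hν le_rfl]
  rw [lintegral_lintegral_swap (aemeasurable_heatSymbol_mul f), Lp.enorm_def f,
    eLpNorm_one_eq_lintegral_enorm, ← lintegral_const_mul'' _ (Lp.aestronglyMeasurable f).enorm]
  refine lintegral_mono fun ξ => ?_
  rw [lintegral_mul_const' _ _ enorm_ne_top]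
  gcongr
  simpa using lintegral_heatSymbol_pow_le hν one_ne_zero (mul_one 2) ξ

variable (E) in
/-- The kernel `|∇| e^{ντΔ}` on the Fourier side. -/
def heatKernel [TopologicalSpace.SeparableSpace E] (hν : 0 < ν) :
    SmoothingKernel (FourierL1 E) (FourierL1 E) where
  op := kernelOp ν 1
  bound := (√(1 / (8 * Real.pi ^ 2 * ν))).toNNReal
  stronglyMeasurable := stronglyMeasurable_kernelOp hν one_le_two
  causal _ := kernelOp_of_nonpos
  lintegral_le := lintegral_sq_kernelOp_one_le hν

end KernelOp

section Convolution

variable {G E E' F : Type*} [AddGroup G] [MeasurableSpace G] [MeasurableAdd₂ G] [MeasurableNeg G]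
  {μ : Measure G} [SFinite μ] [μ.IsAddRightInvariant] [NormedAddCommGroup E] [NormedSpace ℝ E]
  [NormedAddCommGroup E'] [NormedSpace ℝ E'] [NormedAddCommGroup F] [NormedSpace ℝ F]
  (L : E →L[ℝ] E' →L[ℝ] F)

theorem integral_norm_convolution_le {f : G → E} {g : G → E'} (hf : Integrable f μ)
    (hg : Integrable g μ) :
    ∫ x, ‖(f ⋆[L, μ] g) x‖ ∂μ ≤ ‖L‖ * ((∫ x, ‖f x‖ ∂μ) * ∫ x, ‖g x‖ ∂μ) := by
  let M : ℝ →L[ℝ] ℝ →L[ℝ] ℝ := ‖L‖ • ContinuousLinearMap.mul ℝ ℝ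
  calc ∫ x, ‖(f ⋆[L, μ] g) x‖ ∂μ
      ≤ ∫ x, ((fun x => ‖f x‖) ⋆[M, μ] fun x => ‖g x‖) x ∂μ := by
        refine integral_mono_ae (hf.integrable_convolution L hg).norm
          (hf.norm.integrable_convolution M hg.norm) ?_
        filter_upwards [hf.norm.ae_convolution_exists M hg.norm] with x hx
        refine norm_integral_le_of_norm_le hx (Eventually.of_forall fun t => ?_)
        exact (L.le_opNorm₂ _ _).trans_eq (mul_assoc _ _ _)
    _ = ‖L‖ * ((∫ x, ‖f x‖ ∂μ) * ∫ x, ‖g x‖ ∂μ) := integral_convolution M hf.norm hg.norm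

/-- Convolution with respect to the bilinear map `L` on `L¹`. -/
def convL : Lp E 1 μ →L[ℝ] Lp E' 1 μ →L[ℝ] Lp F 1 μ :=
  LinearMap.mkContinuous₂
    (LinearMap.mk₂ ℝ (fun f g => ((L1.integrable_coeFn f).integrable_convolution L
        (L1.integrable_coeFn g)).toL1 (f ⋆[L, μ] g))
      (fun f f' g => by
        rw [← Integrable.toL1_add, Integrable.toL1_eq_toL1_iff,
          convolution_congr L (Lp.coeFn_add f f') (ae_eq_refl g)]
        filter_upwards [(L1.integrable_coeFn f).ae_convolution_exists L (L1.integrable_coeFn g),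
          (L1.integrable_coeFn f').ae_convolution_exists L (L1.integrable_coeFn g)] with x h h'
        exact h.add_distrib h')
      (fun c f g => by
        rw [← Integrable.toL1_smul, Integrable.toL1_eq_toL1_iff,
          convolution_congr L (Lp.coeFn_smul c f) (ae_eq_refl g), smul_convolution]
        exact ae_eq_refl _)
      (fun f g g' => by
        rw [← Integrable.toL1_add, Integrable.toL1_eq_toL1_iff,
          convolution_congr L (ae_eq_refl f) (Lp.coeFn_add g g')]
        filter_upwards [(L1.integrable_coeFn f).ae_convolution_exists L (L1.integrable_coeFn g),
          (L1.integrable_coeFn f).ae_convolution_exists L (L1.integrable_coeFn g')] with x h h'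
        exact h.distrib_add h')
      (fun c f g => by
        rw [← Integrable.toL1_smul, Integrable.toL1_eq_toL1_iff,
          convolution_congr L (ae_eq_refl f) (Lp.coeFn_smul c g), convolution_smul]
        exact ae_eq_refl _))
    ‖L‖ (fun f g => by
      rw [LinearMap.mk₂_apply, L1.norm_of_fun_eq_integral_norm, L1.norm_eq_integral_norm,
        L1.norm_eq_integral_norm, mul_assoc]
      exact integral_norm_convolution_le L (L1.integrable_coeFn f) (L1.integrable_coeFn g))

theorem coeFn_convL (f : Lp E 1 μ) (g : Lp E' 1 μ) : convL L f g =ᵐ[μ] f ⋆[L, μ] g :=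
  Integrable.coeFn_toL1
    ((L1.integrable_coeFn f).integrable_convolution L (L1.integrable_coeFn g))

end Convolution

theorem coeFn_sum {ι α E : Type*} [MeasurableSpace α] {μ : Measure α} [NormedAddCommGroup E]
    {p : ℝ≥0∞} (s : Finset ι) (f : ι → Lp E p μ) :
    (∑ i ∈ s, f i : Lp E p μ) =ᵐ[μ] fun x => ∑ i ∈ s, f i x := by
  classical
  induction s using Finset.induction_on with
  | empty =>
    simp only [Finset.sum_empty]
    exact Lp.coeFn_zero E p μ
  | insert i s hi ih =>
    rw [Finset.sum_insert hi]
    filter_upwards [Lp.coeFn_add (f i) (∑ i ∈ s, f i), ih] with x h_add h_sum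
    rw [h_add, Pi.add_apply, h_sum, Finset.sum_insert hi]

section Nonlinearity

/-- The symbol of the operator of order zero `|∇|⁻¹ ∑_m q^{j,m}_{k,l} ∂_m`. -/
def qSymbol (a : Coeffs) (j k l : Fin 3) (ξ : R3) : ℂ :=
  ∑ m, ∑ n, ∑ p, (a j m p n k l : ℂ) *
    (2 * Real.pi * Complex.I * ((ξ m * ξ n * ξ p / ‖ξ‖ ^ 3 : ℝ) : ℂ))

theorem abs_mul_mul_div_norm_pow_le_one (ξ : R3) (m n p : Fin 3) :
    |ξ m * ξ n * ξ p / ‖ξ‖ ^ 3| ≤ 1 := by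
  have h_coord : ∀ i, |ξ i| ≤ ‖ξ‖ := PiLp.norm_apply_le ξ
  rw [abs_div, abs_mul, abs_mul, abs_of_nonneg (by positivity : 0 ≤ ‖ξ‖ ^ 3)]
  refine div_le_one_of_le₀ ?_ (by positivity)
  calc |ξ m| * |ξ n| * |ξ p| ≤ ‖ξ‖ * ‖ξ‖ * ‖ξ‖ := by gcongr <;> exact h_coord _
    _ = ‖ξ‖ ^ 3 := by ring

theorem memLp_qSymbol (a : Coeffs) (j k l : Fin 3) : MemLp (qSymbol a j k l) ∞ := by
  have h_meas : Measurable (qSymbol a j k l) := by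
    unfold qSymbol
    fun_prop
  refine memLp_top_of_bound h_meas.aestronglyMeasurable
    (∑ m, ∑ n, ∑ p, |a j m p n k l| * (2 * Real.pi)) (Eventually.of_forall fun ξ =>
      norm_sum_le_of_le _ fun m _ => norm_sum_le_of_le _ fun n _ => norm_sum_le_of_le _
        fun p _ => ?_)
  rw [norm_mul, Complex.norm_real, Real.norm_eq_abs]
  gcongr
  rw [norm_mul, Complex.norm_real, Real.norm_eq_abs, norm_mul, Complex.norm_I, mul_one,
    norm_mul, Complex.norm_real, Real.norm_of_nonneg Real.pi_pos.le, Complex.norm_ofNat]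
  exact mul_le_of_le_one_right (by positivity) (abs_mul_mul_div_norm_pow_le_one ξ m n p)

/-- The `k`-th component of a vector field. -/
def compL (k : Fin 3) : FourierL1 C3 →L[ℝ] FourierL1 ℂ :=
  ((EuclideanSpace.proj k : C3 →L[ℂ] ℂ).restrictScalars ℝ).compLpL 1 volume

theorem coeFn_compL (k : Fin 3) (U : FourierL1 C3) : compL k U =ᵐ[volume] fun ξ => U ξ k :=
  ((EuclideanSpace.proj k : C3 →L[ℂ] ℂ).restrictScalars ℝ).coeFn_compLpL U

/-- The vector field with the given `j`-th component and the others zero. -/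
def singleL (j : Fin 3) : FourierL1 ℂ →L[ℝ] FourierL1 C3 :=
  ((ContinuousLinearMap.toSpanSingleton ℂ
    (EuclideanSpace.single j (1 : ℂ))).restrictScalars ℝ).compLpL 1 volume

theorem compL_singleL (i j : Fin 3) (f : FourierL1 ℂ) :
    compL i (singleL j f) = if i = j then f else 0 := by
  have h_single : singleL j f =ᵐ[volume] fun ξ => f ξ • EuclideanSpace.single j (1 : ℂ) :=
    ((ContinuousLinearMap.toSpanSingleton ℂ
      (EuclideanSpace.single j (1 : ℂ))).restrictScalars ℝ).coeFn_compLpL f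
  refine Lp.ext ?_
  filter_upwards [coeFn_compL i (singleL j f), h_single] with ξ h_comp h_single
  rw [h_comp, h_single]
  split_ifs with hij <;> simp [hij]

/-- Convolution of complex functions on `ℝ³`; real bilinearity is all that is needed of it. -/
abbrev conv (f g : R3 → ℂ) : R3 → ℂ := f ⋆[ContinuousLinearMap.mul ℝ ℂ, volume] g

/-- The bilinear operator `|∇|⁻¹ Q` on the Fourier side. -/
def qL (a : Coeffs) : FourierL1 C3 →L[ℝ] FourierL1 C3 →L[ℝ] FourierL1 C3 :=
  ∑ j, ∑ kl : Fin 3 × Fin 3, (ContinuousLinearMap.compL ℝ _ _ _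
    (singleL j ∘L mulLp ℂ volume 1 (qSymbol a j kl.1 kl.2))) ∘L
      (convL (ContinuousLinearMap.mul ℝ ℂ)).bilinearComp (compL kl.1) (compL kl.2)

theorem compL_qL (a : Coeffs) (j : Fin 3) (U V : FourierL1 C3) :
    compL j (qL a U V) = ∑ kl : Fin 3 × Fin 3, mulLp ℂ volume 1 (qSymbol a j kl.1 kl.2)
      (convL (ContinuousLinearMap.mul ℝ ℂ) (compL kl.1 U) (compL kl.2 V)) := by
  simp only [qL, sum_apply, map_sum, ContinuousLinearMap.comp_apply,
    ContinuousLinearMap.compL_apply, ContinuousLinearMap.bilinearComp_apply, compL_singleL]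
  rw [Finset.sum_comm]
  simp only [Finset.sum_ite_eq, Finset.mem_univ, if_true]

theorem coeFn_qL (a : Coeffs) (U V : FourierL1 C3) (j : Fin 3) :
    (fun ξ => qL a U V ξ j) =ᵐ[volume] fun ξ => ∑ k, ∑ l,
      qSymbol a j k l ξ * conv (fun ξ => U ξ k) (fun ξ => V ξ l) ξ := by
  have h_term : ∀ kl : Fin 3 × Fin 3, mulLp ℂ volume 1 (qSymbol a j kl.1 kl.2)
      (convL (ContinuousLinearMap.mul ℝ ℂ) (compL kl.1 U) (compL kl.2 V)) =ᵐ[volume] fun ξ =>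
        qSymbol a j kl.1 kl.2 ξ * conv (fun ξ => U ξ kl.1) (fun ξ => V ξ kl.2) ξ := by
    intro kl
    filter_upwards [coeFn_mulLp (memLp_qSymbol a j kl.1 kl.2)
        (convL (ContinuousLinearMap.mul ℝ ℂ) (compL kl.1 U) (compL kl.2 V)),
      coeFn_convL (ContinuousLinearMap.mul ℝ ℂ) (compL kl.1 U) (compL kl.2 V)]
      with ξ h_mul h_conv
    rw [h_mul, h_conv, convolution_congr _ (coeFn_compL kl.1 U) (coeFn_compL kl.2 V), smul_eq_mul]
  have h_sum := coeFn_compL j (qL a U V)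
  rw [compL_qL] at h_sum
  filter_upwards [h_sum, coeFn_sum Finset.univ fun kl : Fin 3 × Fin 3 =>
    mulLp ℂ volume 1 (qSymbol a j kl.1 kl.2)
      (convL (ContinuousLinearMap.mul ℝ ℂ) (compL kl.1 U) (compL kl.2 V)), ae_all_iff.2 h_term]
    with ξ h_comp h_sum h_term
  rw [← h_comp, h_sum]
  simp only [h_term, Fintype.sum_prod_type]

end Nonlinearity

section Represents

variable {F : Type*} [NormedAddCommGroup F] [NormedSpace ℂ F]

theorem Represents.congr {T : 𝓢'(R3, F)} {g h : R3 → F} (hg : Represents T g)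
    (hgh : g =ᵐ[volume] h) : Represents T h := by
  have h_smul : ∀ φ : 𝓢(R3, ℂ), (fun x => φ x • g x) =ᵐ[volume] fun x => φ x • h x := fun φ =>
    (ae_eq_refl φ).smul hgh
  exact ⟨hg.1.congr hgh, fun φ => (hg.2.1 φ).congr (h_smul φ),
    fun φ => (hg.2.2 φ).trans (integral_congr_ae (h_smul φ))⟩

theorem Represents.unique {T S : 𝓢'(R3, F)} {g : R3 → F} (hT : Represents T g)
    (hS : Represents S g) : T = S := by
  ext φ
  rw [hT.2.2, hS.2.2]

theorem represents_funOf {T : 𝓢'(R3, F)} (hT : ∃ g, Represents T g) :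
    Represents T (funOf T) := by
  rw [funOf, dif_pos hT]
  exact hT.choose_spec

theorem Represents.funOf_ae_eq [CompleteSpace F] {T : 𝓢'(R3, F)} {g : R3 → F}
    (hT : Represents T g) : funOf T =ᵐ[volume] g :=
  (represents_funOf ⟨g, hT⟩).ae_eq hT

theorem Represents.distOf_eq {T : 𝓢'(R3, F)} {g : R3 → F} (hT : Represents T g) :
    distOf g = T := by
  have h_exists : ∃ T, Represents T g := ⟨T, hT⟩
  rw [distOf, dif_pos h_exists]
  exact h_exists.choose_spec.unique hT

theorem Represents.sum {ι : Type*} (s : Finset ι) {T : ι → 𝓢'(R3, F)} {g : ι → R3 → F}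
    (h : ∀ i ∈ s, Represents (T i) (g i)) : Represents (∑ i ∈ s, T i) (∑ i ∈ s, g i) := by
  classical
  induction s using Finset.induction_on with
  | empty => exact Represents.zero
  | insert i s hi ih =>
    rw [Finset.sum_insert hi, Finset.sum_insert hi]
    exact (h i (Finset.mem_insert_self i s)).add (ih fun j hj => h j (Finset.mem_insert_of_mem hj))

theorem Represents.smulLeft {T : 𝓢'(R3, F)} {g : R3 → F} (hT : Represents T g) {w : R3 → ℂ}
    (hw : w.HasTemperateGrowth) :
    Represents (TemperedDistribution.smulLeftCLM F w T) (fun x => w x • g x) := by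
  have h_transpose : ∀ φ : 𝓢(R3, ℂ), (fun x => φ x • w x • g x) =
      fun x => SchwartzMap.smulLeftCLM ℂ w φ x • g x := by
    intro φ
    ext1 x
    rw [SchwartzMap.smulLeftCLM_apply_apply hw, smul_smul, smul_eq_mul, mul_comm]
  refine ⟨hT.1.continuous_smul hw.1.continuous, fun φ => ?_, fun φ => ?_⟩
  · rw [h_transpose φ]
    exact hT.2.1 _
  · rw [h_transpose φ, TemperedDistribution.smulLeftCLM_apply_apply]
    exact hT.2.2 _

theorem Represents.apply_eq_integral_fourierInv {T : 𝓢'(R3, F)} {g : R3 → F}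
    (hT : Represents (𝓕 T) g) (φ : 𝓢(R3, ℂ)) : T φ = ∫ ξ, (𝓕⁻ φ) ξ • g ξ := by
  rw [← hT.2.2, TemperedDistribution.fourier_apply, FourierTransform.fourier_fourierInv_eq]

theorem memLp_top_fourierInv {f : R3 → F} (hf : Integrable f) : MemLp (𝓕⁻ f) ∞ := by
  have h_cont : Continuous (𝓕⁻ f) := by
    refine VectorFourier.fourierIntegral_continuous Real.continuous_fourierChar ?_ hf
    simp only [LinearMap.neg_apply, innerₗ_apply_apply]
    fun_prop
  exact memLp_top_of_bound h_cont.aestronglyMeasurable (∫ ξ, ‖f ξ‖)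
    (Eventually.of_forall (VectorFourier.norm_fourierIntegral_le_integral_norm _ _ _ f))

theorem integral_fourierInv_smul_eq [CompleteSpace F] {f : R3 → F} (hf : Integrable f)
    (φ : 𝓢(R3, ℂ)) : ∫ ξ, (𝓕⁻ φ) ξ • f ξ = ∫ x, φ x • (𝓕⁻ f) x := by
  have h_cont : Continuous fun z : R3 × R3 => (-innerₗ R3) z.1 z.2 := by
    simp only [LinearMap.neg_apply, innerₗ_apply_apply]
    fun_prop
  have h_flip : (-innerₗ R3).flip = -innerₗ R3 := by
    ext x y
    simp [real_inner_comm]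
  have h := VectorFourier.integral_fourierIntegral_smul_eq_flip (μ := (volume : Measure R3))
    (ν := (volume : Measure R3)) (L := -innerₗ R3) Real.continuous_fourierChar h_cont
    φ.integrable hf
  rw [h_flip] at h
  rw [SchwartzMap.fourierInv_coe]
  exact h

variable [CompleteSpace F]

theorem exists_represents_of_memLp {p : ℝ≥0∞} (hp : 1 ≤ p) {g : R3 → F} (hg : MemLp g p) :
    ∃ T, Represents T g := by
  have : Fact (1 ≤ p) := ⟨hp⟩
  have : p.HolderConjugate (1 - p⁻¹)⁻¹ := ENNReal.HolderConjugate.inv_one_sub_inv' hp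
  refine ⟨Lp.toTemperedDistribution hg.toLp, Represents.congr ⟨(Lp.memLp _).locallyIntegrable hp,
    fun φ => ?_, Lp.toTemperedDistribution_apply hg.toLp⟩ hg.coeFn_toLp⟩
  exact memLp_one_iff_integrable.1 ((Lp.memLp hg.toLp).smul (φ.memLp (1 - p⁻¹)⁻¹ volume))

theorem exists_represents_of_integrable_inv_smul {g : R3 → F}
    (hg : Integrable fun x => (1 + ‖x‖ ^ 2)⁻¹ • g x) : ∃ T, Represents T g := by
  obtain ⟨T, hT⟩ := exists_represents_of_memLp le_rfl (memLp_one_iff_integrable.2 hg)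
  have h_weight : (fun x : R3 => ((1 + ‖x‖ ^ 2 : ℝ) : ℂ)).HasTemperateGrowth :=
    Function.Complex.hasTemperateGrowth_ofReal.comp
      ((Function.HasTemperateGrowth.const (1 : ℝ)).add (Function.hasTemperateGrowth_norm_sq R3))
  refine ⟨_, (hT.smulLeft h_weight).congr (Eventually.of_forall fun x => ?_)⟩
  simp only [Complex.coe_smul]
  rw [smul_inv_smul₀ (by positivity)]

theorem represents_fourierInv {T : 𝓢'(R3, F)} {f : R3 → F} (hf : Integrable f)
    (hT : Represents (𝓕 T) f) : Represents T (𝓕⁻ f) := by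
  obtain ⟨S, hS⟩ := exists_represents_of_memLp le_top (memLp_top_fourierInv hf)
  have h_eq : T = S := by
    ext φ
    rw [hT.apply_eq_integral_fourierInv, integral_fourierInv_smul_eq hf, hS.2.2]
  rwa [h_eq]

theorem represents_fourier_of_fourierInv {T : 𝓢'(R3, F)} {f : R3 → F} (hf : Integrable f)
    (hT : Represents T (𝓕⁻ f)) : Represents (𝓕 T) f := by
  obtain ⟨S, hS⟩ := exists_represents_of_memLp le_rfl (memLp_one_iff_integrable.2 hf)
  have h_eq : 𝓕 T = S := by
    ext φ
    rw [TemperedDistribution.fourier_apply, hT.2.2, ← integral_fourierInv_smul_eq hf,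
      FourierTransform.fourierInv_fourier_eq, hS.2.2]
  rwa [h_eq]

end Represents

section Operators

theorem hasTemperateGrowth_gauss {τ : ℝ} (hτ : 0 ≤ τ) :
    (fun ξ : R3 => ((gauss τ ξ : ℝ) : ℂ)).HasTemperateGrowth := by
  have h_quadratic : (fun ξ : R3 => τ * (2 * Real.pi) ^ 2 * ‖ξ‖ ^ 2).HasTemperateGrowth :=
    (Function.HasTemperateGrowth.const _).mul (Function.hasTemperateGrowth_norm_sq R3)
  have h_smooth : ContDiff ℝ (⊤ : ℕ∞) fun x : ℝ => Real.exp (-x) := by fun_prop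
  have h_deriv : ∀ (n : ℕ) (x : ℝ), 0 ≤ x →
      ‖iteratedFDerivWithin ℝ n (fun x : ℝ => Real.exp (-x)) (Ici 0) x‖ ≤ 1 := by
    intro n x hx
    rw [norm_iteratedFDerivWithin_eq_norm_iteratedDerivWithin,
      iteratedDerivWithin_eq_iteratedDeriv (uniqueDiffOn_Ici 0)
        (h_smooth.contDiffAt.of_le (mod_cast le_top)) hx, iteratedDeriv_comp_neg,
      iteratedDeriv_eq_iterate, Real.iter_deriv_exp]
    simpa using hx
  -- `x ↦ e^{-x}` has bounded derivatives only on the half line, which contains the values of the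
  -- quadratic form.
  have h_comp := h_quadratic.comp' (g := fun x : ℝ => Real.exp (-x)) (t := Ici 0)
    (by rintro _ ⟨ξ, rfl⟩; exact mem_Ici.2 (by positivity)) (uniqueDiffOn_Ici 0)
    h_smooth.contDiffOn (fun _ => ⟨0, 1, zero_le_one, fun n _ x hx => by
      simpa using h_deriv n x hx⟩)
  convert! Function.Complex.hasTemperateGrowth_ofReal.comp h_comp using 1
  ext ξ
  simp only [gauss, Function.comp_apply]
  congr 2
  ring

theorem represents_fourier_heat {F : Type*} [NormedAddCommGroup F] [NormedSpace ℂ F]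
    {T : 𝓢'(R3, F)} {g : R3 → F} (hT : Represents (𝓕 T) g) {τ : ℝ} (hτ : 0 ≤ τ) :
    Represents (𝓕 (heat τ T)) (fun ξ => gauss τ ξ • g ξ) := by
  rw [heat, TemperedDistribution.fourierMultiplierCLM_apply,
    FourierTransform.fourier_fourierInv_eq]
  exact hT.smulLeft (hasTemperateGrowth_gauss hτ)

theorem represents_fourier_lineDeriv {T : 𝓢'(R3, ℂ)} {g : R3 → ℂ} (hT : Represents (𝓕 T) g)
    (m : Fin 3) : Represents (𝓕 (∂_{EuclideanSpace.single m (1 : ℝ)} T))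
      (fun ξ => 2 * Real.pi * Complex.I * (ξ m : ℂ) * g ξ) := by
  have h_symbol : (fun ξ : R3 =>
      ((inner ℝ ξ (EuclideanSpace.single m (1 : ℝ)) : ℝ) : ℂ)).HasTemperateGrowth :=
    Function.Complex.hasTemperateGrowth_ofReal.comp
      (Function.hasTemperateGrowth_inner_left (EuclideanSpace.single m (1 : ℝ)))
  rw [TemperedDistribution.fourier_lineDerivOp_eq]
  refine ((hT.smulLeft h_symbol).smul (2 * Real.pi * Complex.I)).congr
    (Eventually.of_forall fun ξ => ?_)
  simp [EuclideanSpace.inner_single_right, mul_assoc]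

theorem represents_fourier_riesz {b : 𝓢'(R3, ℂ)} {g : R3 → ℂ} (hb : Represents (𝓕 b) g)
    (hg : Integrable fun ξ => (1 + ‖ξ‖ ^ 2)⁻¹ • g ξ) (n p : Fin 3) :
    Represents (𝓕 (riesz n p b)) (fun ξ => ((ξ n * ξ p / ‖ξ‖ ^ 2 : ℝ) : ℂ) * g ξ) := by
  have h_le : ∀ ξ : R3, ‖((ξ n * ξ p / ‖ξ‖ ^ 2 : ℝ) : ℂ)‖ ≤ 1 := by
    intro ξ
    rw [Complex.norm_real, norm_div, norm_mul, norm_pow, norm_norm, sq]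
    refine div_le_one_of_le₀ ?_ (by positivity)
    gcongr <;> exact PiLp.norm_apply_le ξ _
  have h_meas : Measurable fun ξ : R3 => ((ξ n * ξ p / ‖ξ‖ ^ 2 : ℝ) : ℂ) := by fun_prop
  have h_int : Integrable fun ξ : R3 =>
      (1 + ‖ξ‖ ^ 2)⁻¹ • (((ξ n * ξ p / ‖ξ‖ ^ 2 : ℝ) : ℂ) * g ξ) := by
    refine (hg.bdd_mul h_meas.aestronglyMeasurable (Eventually.of_forall h_le)).congr
      (Eventually.of_forall fun ξ => ?_)
    exact mul_smul_comm _ _ _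
  obtain ⟨T, hT⟩ := exists_represents_of_integrable_inv_smul h_int
  have h_dist : distOf (fun ξ : R3 => ((ξ n * ξ p / ‖ξ‖ ^ 2 : ℝ) : ℂ) * funOf (𝓕 b) ξ) = T :=
    (hT.congr ((ae_eq_refl _).mul hb.funOf_ae_eq.symm)).distOf_eq
  rw [riesz, h_dist, FourierTransform.fourier_fourierInv_eq]
  exact hT

theorem fourierInv_apply {f : R3 → C3} (hf : Integrable f) (x : R3) (k : Fin 3) :
    (𝓕⁻ f) x k = (𝓕⁻ fun ξ => f ξ k) x := by
  have h_int : Integrable fun ξ => Real.fourierChar (inner ℝ ξ x) • f ξ := by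
    simpa using (Real.fourierIntegral_convergent_iff (-x)).2 hf
  rw [Real.fourierInv_eq, Real.fourierInv_eq]
  exact ((EuclideanSpace.proj k : C3 →L[ℂ] ℂ).integral_comp_comm h_int).symm

theorem integrable_apply {f : R3 → C3} (hf : Integrable f) (k : Fin 3) :
    Integrable fun ξ => f ξ k :=
  (EuclideanSpace.proj k : C3 →L[ℂ] ℂ).integrable_comp hf

theorem represents_fourier_prodComp {u v : 𝓢'(R3, C3)} {f g : R3 → C3} (hf : Integrable f)
    (hg : Integrable g) (hu : Represents (𝓕 u) f) (hv : Represents (𝓕 v) g) (k l : Fin 3) :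
    Represents (𝓕 (prodComp k l u v)) (conv (fun ξ => f ξ k) (fun ξ => g ξ l)) := by
  have h_int : Integrable (conv (fun ξ => f ξ k) (fun ξ => g ξ l)) :=
    (integrable_apply hf k).integrable_convolution _ (integrable_apply hg l)
  have h_mul : 𝓕⁻ (conv (fun ξ => f ξ k) (fun ξ => g ξ l)) =ᵐ[volume]
      fun x => funOf u x k * funOf v x l := by
    filter_upwards [(represents_fourierInv hf hu).funOf_ae_eq,
      (represents_fourierInv hg hv).funOf_ae_eq] with x hu hv
    rw [hu, hv, fourierInv_apply hf, fourierInv_apply hg, Real.fourierInv_eq_fourier_neg,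
      Real.fourierInv_eq_fourier_neg, Real.fourierInv_eq_fourier_neg]
    exact Real.fourier_mul_convolution_eq (integrable_apply hf k) (integrable_apply hg l) (-x)
  obtain ⟨T, hT⟩ := exists_represents_of_memLp le_top (memLp_top_fourierInv h_int)
  rw [prodComp, (hT.congr h_mul).distOf_eq]
  exact represents_fourier_of_fourierInv h_int hT

theorem integrable_inv_smul_coord_mul {f : R3 → ℂ} (hf : Integrable f) (m : Fin 3) :
    Integrable fun ξ : R3 => (1 + ‖ξ‖ ^ 2)⁻¹ • (2 * Real.pi * Complex.I * (ξ m : ℂ) * f ξ) := by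
  have h_meas : Measurable fun ξ : R3 =>
      (1 + ‖ξ‖ ^ 2)⁻¹ • (2 * Real.pi * Complex.I * (ξ m : ℂ)) := by fun_prop
  have h_le : ∀ ξ : R3, ‖(1 + ‖ξ‖ ^ 2)⁻¹ • (2 * Real.pi * Complex.I * (ξ m : ℂ))‖ ≤
      2 * Real.pi := by
    intro ξ
    have h_coord : ‖ξ m‖ ≤ 1 + ‖ξ‖ ^ 2 := by
      nlinarith [PiLp.norm_apply_le ξ m, sq_nonneg (‖ξ‖ - 1), norm_nonneg ξ]
    rw [norm_smul, norm_inv, Real.norm_of_nonneg (by positivity : 0 ≤ 1 + ‖ξ‖ ^ 2), norm_mul,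
      norm_mul, norm_mul, Complex.norm_I, Complex.norm_real, Complex.norm_real,
      Complex.norm_ofNat, Real.norm_of_nonneg Real.pi_pos.le, mul_one,
      inv_mul_le_iff₀ (by positivity), mul_comm (1 + ‖ξ‖ ^ 2)]
    gcongr
  refine (hf.bdd_mul h_meas.aestronglyMeasurable (Eventually.of_forall h_le)).congr
    (Eventually.of_forall fun ξ => smul_mul_assoc _ _ _)

theorem norm_mul_qSymbol (a : Coeffs) (j k l : Fin 3) (ξ : R3) :
    (‖ξ‖ : ℂ) * qSymbol a j k l ξ = ∑ m, ∑ n, ∑ p, (a j m p n k l : ℂ) *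
      (((ξ n * ξ p / ‖ξ‖ ^ 2 : ℝ) : ℂ) * (2 * Real.pi * Complex.I * (ξ m : ℂ))) := by
  simp only [qSymbol, Finset.mul_sum]
  refine Finset.sum_congr rfl fun m _ => Finset.sum_congr rfl fun n _ =>
    Finset.sum_congr rfl fun p _ => ?_
  rcases eq_or_ne ξ 0 with rfl | hξ
  · simp
  · have : (‖ξ‖ : ℂ) ≠ 0 := by simpa using hξ
    push_cast
    field_simp

theorem represents_fourier_Q (a : Coeffs) {u v : 𝓢'(R3, C3)} {f g : R3 → C3} (hf : Integrable f)
    (hg : Integrable g) (hu : Represents (𝓕 u) f) (hv : Represents (𝓕 v) g) (j : Fin 3) :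
    Represents (𝓕 (Q a j u v)) (fun ξ => ‖ξ‖ • ∑ k, ∑ l, qSymbol a j k l ξ *
      conv (fun ξ => f ξ k) (fun ξ => g ξ l) ξ) := by
  have h_term : ∀ k l m n p, Represents (𝓕 ((a j m p n k l : ℂ) • riesz n p
      (∂_{EuclideanSpace.single m (1 : ℝ)} (prodComp k l u v))))
      ((a j m p n k l : ℂ) • fun ξ : R3 => ((ξ n * ξ p / ‖ξ‖ ^ 2 : ℝ) : ℂ) *
        (2 * Real.pi * Complex.I * (ξ m : ℂ) * conv (fun ξ => f ξ k) (fun ξ => g ξ l) ξ)) := by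
    intro k l m n p
    rw [FourierTransform.fourier_smul]
    refine (represents_fourier_riesz (represents_fourier_lineDeriv
      (represents_fourier_prodComp hf hg hu hv k l) m) ?_ n p).smul _
    exact integrable_inv_smul_coord_mul
      ((integrable_apply hf k).integrable_convolution _ (integrable_apply hg l)) m
  have h_sum := Represents.sum Finset.univ fun k _ => Represents.sum Finset.univ fun l _ =>
    Represents.sum Finset.univ fun m _ => Represents.sum Finset.univ fun n _ =>
      Represents.sum Finset.univ fun p _ => h_term k l m n p
  simp only [Q, qOp, FourierTransform.fourier_sum]
  refine h_sum.congr (Eventually.of_forall fun ξ => ?_)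
  simp only [Finset.sum_apply, Pi.smul_apply, Complex.real_smul, Finset.mul_sum, ← mul_assoc,
    norm_mul_qSymbol, Finset.sum_mul, smul_eq_mul]

end Operators

section WeightedFourier

variable {F : Type*} [NormedAddCommGroup F] [NormedSpace ℂ F] {i : ℤ}

theorem eq_of_represents_fourier {T S : 𝓢'(R3, F)} {g : R3 → F} (hT : Represents (𝓕 T) g)
    (hS : Represents (𝓕 S) g) : T = S := by
  simpa only [FourierTransform.fourierInv_fourier_eq] using
    congrArg (fun T : 𝓢'(R3, F) => (𝓕⁻ T : 𝓢'(R3, F))) (hT.unique hS)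

theorem ae_ne_zero : ∀ᵐ ξ : R3, ξ ≠ 0 := by simp [ae_iff]

open Classical in
/-- The weighted Fourier transform `ξ ↦ |ξ|^i f̂(ξ)`, which identifies `χ^i` with `L¹`; it is `0` if
`f` is not in `χ^i`. -/
def weightedFourier (i : ℤ) (f : 𝓢'(R3, F)) : FourierL1 F :=
  if h : Integrable fun ξ => ‖ξ‖ ^ i • funOf (𝓕 f) ξ then h.toL1 else 0

/-- The distribution with Fourier transform `|ξ|^{-i} h(ξ)`: the inverse of `weightedFourier i`. It
is meaningful for `-2 ≤ i ≤ 0`. -/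
def ofWeightedFourier (i : ℤ) (h : FourierL1 F) : 𝓢'(R3, F) :=
  𝓕⁻ (distOf fun ξ => ‖ξ‖ ^ (-i) • h ξ)

theorem enorm_zpow_smul (i : ℤ) (g : R3 → F) (ξ : R3) :
    ‖‖ξ‖ ^ i • g ξ‖ₑ = ENNReal.ofReal (‖ξ‖ ^ i) * ‖g ξ‖ₑ := by
  rw [enorm_smul, Real.enorm_of_nonneg (by positivity)]

theorem ae_zpow_smul_zpow_smul (i k : ℤ) (h : R3 → F) :
    (fun ξ => ‖ξ‖ ^ k • ‖ξ‖ ^ (-i) • h ξ) =ᵐ[volume] fun ξ => ‖ξ‖ ^ (k - i) • h ξ := by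
  filter_upwards [ae_ne_zero] with ξ hξ
  rw [smul_smul, ← zpow_add₀ (norm_ne_zero_iff.2 hξ), sub_eq_add_neg]

variable [CompleteSpace F]

theorem coeFn_weightedFourier {f : 𝓢'(R3, F)} (hf : chiENorm i f < ∞) {g : R3 → F}
    (hg : Represents (𝓕 f) g) : weightedFourier i f =ᵐ[volume] fun ξ => ‖ξ‖ ^ i • g ξ := by
  have h_rep := represents_funOf (exists_represents hf)
  have h_weight : Measurable fun ξ : R3 => ‖ξ‖ ^ i := by fun_prop
  have h_int : Integrable fun ξ => ‖ξ‖ ^ i • funOf (𝓕 f) ξ := by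
    refine ⟨h_weight.aestronglyMeasurable.smul h_rep.1.aestronglyMeasurable, ?_⟩
    simp only [HasFiniteIntegral, enorm_zpow_smul]
    rwa [← chiENorm_eq i h_rep]
  rw [weightedFourier, dif_pos h_int]
  filter_upwards [h_int.coeFn_toL1, hg.funOf_ae_eq] with ξ hξ hg_eq
  rw [hξ, hg_eq]

theorem enorm_weightedFourier {f : 𝓢'(R3, F)} (hf : chiENorm i f < ∞) :
    ‖weightedFourier i f‖ₑ = chiENorm i f := by
  obtain ⟨g, hg⟩ := exists_represents hf
  rw [Lp.enorm_def, eLpNorm_one_eq_lintegral_enorm, chiENorm_eq i hg]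
  refine lintegral_congr_ae ?_
  filter_upwards [coeFn_weightedFourier hf hg] with ξ hξ
  rw [hξ, enorm_zpow_smul]

theorem weightedFourier_sub {f g : 𝓢'(R3, F)} (hf : chiENorm i f < ∞) (hg : chiENorm i g < ∞) :
    weightedFourier i (f - g) = weightedFourier i f - weightedFourier i g := by
  obtain ⟨f', hf'⟩ := exists_represents hf
  obtain ⟨g', hg'⟩ := exists_represents hg
  have h_sub : Represents (𝓕 (f - g)) (f' + (-1 : ℂ) • g') := by
    have h_eq : f - g = f + (-1 : ℂ) • g := by
      ext φ
      change f φ - g φ = f φ + (-1 : ℂ) • g φ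
      rw [neg_smul, one_smul, sub_eq_add_neg]
    rw [h_eq, FourierTransform.fourier_add, FourierTransform.fourier_smul]
    exact hf'.add (hg'.smul _)
  refine Lp.ext ?_
  filter_upwards [coeFn_weightedFourier hf hf', coeFn_weightedFourier hg hg',
    coeFn_weightedFourier ((chiSubmodule F i).sub_mem hf hg) h_sub,
    Lp.coeFn_sub (weightedFourier i f) (weightedFourier i g)] with ξ hf hg hfg h_coe
  rw [hfg, h_coe, Pi.sub_apply, hf, hg, Pi.add_apply, Pi.smul_apply, neg_smul, one_smul,
    ← sub_eq_add_neg, smul_sub]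

theorem isometry_weightedFourier (i : ℤ) :
    Isometry fun f : Chi F i => weightedFourier i f.toDist := by
  refine Isometry.of_dist_eq fun f g => ?_
  have h_sub : weightedFourier i (f.toDist - g.toDist) =
      weightedFourier i f.toDist - weightedFourier i g.toDist := weightedFourier_sub f.2 g.2
  have h_norm : ‖weightedFourier i (f.toDist - g.toDist)‖ₑ = chiENorm i (f.toDist - g.toDist) :=
    enorm_weightedFourier ((chiSubmodule F i).sub_mem f.2 g.2)
  rw [dist_eq_norm, dist_eq_norm, ← h_sub, ← toReal_enorm, h_norm]
  rfl

theorem norm_weightedFourier (f : Chi F i) : ‖weightedFourier i f.toDist‖ = ‖f‖ := by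
  rw [← toReal_enorm, enorm_weightedFourier (show chiENorm i f.toDist < ∞ from f.2)]
  rfl

theorem represents_fourier_ofWeightedFourier (hi : i ∈ Icc (-2) 0) (h : FourierL1 F) :
    Represents (𝓕 (ofWeightedFourier i h)) (fun ξ => ‖ξ‖ ^ (-i) • h ξ) := by
  have h_weight : Measurable fun ξ : R3 => (1 + ‖ξ‖ ^ 2)⁻¹ * ‖ξ‖ ^ (-i) := by fun_prop
  have h_le : ∀ ξ : R3, ‖(1 + ‖ξ‖ ^ 2)⁻¹ * ‖ξ‖ ^ (-i)‖ ≤ 1 := by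
    intro ξ
    rw [Real.norm_of_nonneg (by positivity), inv_mul_le_one₀ (by positivity)]
    obtain ⟨hi₁, hi₂⟩ := hi
    interval_cases i
    · exact le_add_of_nonneg_left zero_le_one
    · norm_num
      nlinarith [sq_nonneg (‖ξ‖ - 1)]
    · simp
  obtain ⟨T, hT⟩ := exists_represents_of_integrable_inv_smul (g := fun ξ => ‖ξ‖ ^ (-i) • h ξ)
    (((L1.integrable_coeFn h).bdd_smul 1 h_weight.aestronglyMeasurable
      (Eventually.of_forall h_le)).congr (Eventually.of_forall fun ξ => by
        simp only [Pi.smul_apply', mul_smul]))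
  rw [ofWeightedFourier, hT.distOf_eq, FourierTransform.fourier_fourierInv_eq]
  exact hT

theorem represents_fourier_ofWeightedFourier_zero (h : FourierL1 F) :
    Represents (𝓕 (ofWeightedFourier 0 h)) h := by
  simpa using represents_fourier_ofWeightedFourier (i := 0) (by simp) h

theorem chiENorm_ofWeightedFourier_of_ae_eq {k : ℤ} (hi : i ∈ Icc (-2) 0) {h W : FourierL1 F}
    (hW : W =ᵐ[volume] fun ξ => ‖ξ‖ ^ (k - i) • h ξ) :
    chiENorm k (ofWeightedFourier i h) = ‖W‖ₑ := by
  rw [chiENorm_eq k (represents_fourier_ofWeightedFourier hi h), Lp.enorm_def,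
    eLpNorm_one_eq_lintegral_enorm]
  refine lintegral_congr_ae ?_
  filter_upwards [ae_zpow_smul_zpow_smul i k h, hW] with ξ h_pow hξ
  rw [hξ, ← h_pow]
  exact (enorm_zpow_smul k (fun ξ => ‖ξ‖ ^ (-i) • h ξ) ξ).symm

theorem weightedFourier_ofWeightedFourier_of_ae_eq {k : ℤ} (hi : i ∈ Icc (-2) 0)
    {h W : FourierL1 F} (hW : W =ᵐ[volume] fun ξ => ‖ξ‖ ^ (k - i) • h ξ) :
    weightedFourier k (ofWeightedFourier i h) = W := by
  refine Lp.ext (((coeFn_weightedFourier ?_ (represents_fourier_ofWeightedFourier hi h)).trans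
    (ae_zpow_smul_zpow_smul i k h)).trans hW.symm)
  rw [chiENorm_ofWeightedFourier_of_ae_eq hi hW]
  exact enorm_lt_top

theorem chiENorm_ofWeightedFourier_lt_top (hi : i ∈ Icc (-2) 0) (h : FourierL1 F) :
    chiENorm i (ofWeightedFourier i h) < ∞ := by
  rw [chiENorm_ofWeightedFourier_of_ae_eq hi (W := h) (Eventually.of_forall fun ξ => by simp)]
  exact enorm_lt_top

theorem weightedFourier_ofWeightedFourier (hi : i ∈ Icc (-2) 0) (h : FourierL1 F) :
    weightedFourier i (ofWeightedFourier i h) = h :=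
  weightedFourier_ofWeightedFourier_of_ae_eq hi (Eventually.of_forall fun ξ => by simp)

theorem ofWeightedFourier_weightedFourier (hi : i ∈ Icc (-2) 0) {f : 𝓢'(R3, F)}
    (hf : chiENorm i f < ∞) : ofWeightedFourier i (weightedFourier i f) = f := by
  obtain ⟨g, hg⟩ := exists_represents hf
  refine eq_of_represents_fourier (represents_fourier_ofWeightedFourier hi _) (hg.congr ?_)
  filter_upwards [coeFn_weightedFourier hf hg, ae_ne_zero] with ξ h_eq hξ
  rw [h_eq, smul_smul, zpow_neg, inv_mul_cancel₀ (zpow_ne_zero _ (norm_ne_zero_iff.2 hξ)),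
    one_smul]

end WeightedFourier

section Pairing

variable {F : Type*} [NormedAddCommGroup F] [NormedSpace ℂ F] [CompleteSpace F] {i : ℤ}

/-- The functional `h ↦ ⟨ofWeightedFourier i h, φ⟩` on `L¹`, for `i ≤ 0`. -/
def pairing (i : ℤ) (φ : 𝓢(R3, ℂ)) : FourierL1 F →L[ℝ] F :=
  L1.integralCLM ∘L mulLp F volume 1 (fun ξ => ‖ξ‖ ^ (-i) • (𝓕⁻ φ) ξ)

theorem memLp_zpow_smul_schwartz (hi : i ≤ 0) (ψ : 𝓢(R3, ℂ)) :
    MemLp (fun ξ : R3 => ‖ξ‖ ^ (-i) • ψ ξ) ∞ := by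
  obtain ⟨m, hm⟩ := Int.eq_ofNat_of_zero_le (neg_nonneg.2 hi)
  obtain ⟨C, -, hC⟩ := ψ.decay m 0
  simp only [hm, zpow_natCast]
  refine memLp_top_of_bound ?_ C (Eventually.of_forall fun ξ => ?_)
  · exact ((continuous_norm.pow m).smul ψ.continuous).aestronglyMeasurable
  · rw [norm_smul, norm_pow, norm_norm]
    simpa only [norm_iteratedFDeriv_zero] using hC ξ

theorem pairing_eq_integral (i : ℤ) (φ : 𝓢(R3, ℂ)) (h : FourierL1 F) :
    pairing i φ h = ∫ ξ, mulLp F volume 1 (fun ξ => ‖ξ‖ ^ (-i) • (𝓕⁻ φ) ξ) h ξ := by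
  rw [← L1.integral_eq_integral, L1.integral_def]
  rfl

theorem ofWeightedFourier_apply (hi : i ∈ Icc (-2) 0) (h : FourierL1 F) (φ : 𝓢(R3, ℂ)) :
    ofWeightedFourier i h φ = pairing i φ h := by
  rw [(represents_fourier_ofWeightedFourier hi h).apply_eq_integral_fourierInv,
    pairing_eq_integral]
  refine integral_congr_ae ?_
  filter_upwards [coeFn_mulLp (memLp_zpow_smul_schwartz hi.2 (𝓕⁻ φ)) h] with ξ hξ
  rw [hξ, smul_comm, smul_assoc]

theorem pairing_apply (hi : i ≤ 0) (φ : 𝓢(R3, ℂ)) (h : FourierL1 C3) (j : Fin 3) :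
    pairing i φ h j = ∫ ξ, (𝓕⁻ φ) ξ * ‖ξ‖ ^ (-i) • h ξ j := by
  rw [pairing_eq_integral]
  refine ((EuclideanSpace.proj j : C3 →L[ℂ] ℂ).integral_comp_comm
    (L1.integrable_coeFn _)).symm.trans (integral_congr_ae ?_)
  filter_upwards [coeFn_mulLp (memLp_zpow_smul_schwartz hi (𝓕⁻ φ)) h] with ξ hξ
  rw [hξ, map_smul, PiLp.proj_apply, smul_assoc, smul_eq_mul, mul_smul_comm]

end Pairing

section TimeSpaces

variable {F : Type*} [NormedAddCommGroup F] [NormedSpace ℂ F] [CompleteSpace F] {i : ℤ}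
  {p : ℝ≥0∞} {T : ℝ} {u : ℝ → 𝓢'(R3, F)}

theorem ae_restrict_Icc_iff {a b : ℝ} {P : ℝ → Prop} :
    (∀ᵐ t ∂volume.restrict (Icc a b), P t) ↔ ∀ᵐ t, t ∈ Ioc a b → P t := by
  rw [Measure.restrict_congr_set Ioc_ae_eq_Icc.symm, ae_restrict_iff' measurableSet_Ioc]

theorem exists_chi_lift (i : ℤ) (u : ℝ → 𝓢'(R3, F)) :
    ∃ v : ℝ → Chi F i, ∀ t, chiENorm i (u t) < ∞ → (v t).toDist = u t := by
  have h_lift : ∀ t, ∃ w : Chi F i, chiENorm i (u t) < ∞ → w.toDist = u t := fun t => by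
    by_cases ht : chiENorm i (u t) < ∞
    · exact ⟨(⟨u t, ht⟩ : chiSubmodule F i), fun _ => rfl⟩
    · exact ⟨0, fun h => absurd h ht⟩
  choose v hv using h_lift
  exact ⟨v, hv⟩

theorem memLp_weightedFourier_iff {v : ℝ → Chi F i} {μ : Measure ℝ} :
    MemLp (fun t => weightedFourier i (v t).toDist) p μ ↔ MemLp v p μ := by
  refine and_congr (isometry_weightedFourier i).isEmbedding.aestronglyMeasurable_comp_iff ?_
  rw [eLpNorm_congr_norm_ae (Eventually.of_forall fun t => norm_weightedFourier (v t))]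

theorem memLpChi_of_weightedFourier
    (h : MemLp (fun t => weightedFourier i (u t)) p (volume.restrict (Icc 0 T)))
    (hu : ∀ᵐ t ∂volume.restrict (Icc 0 T), chiENorm i (u t) < ∞) : MemLpChi p i T u := by
  obtain ⟨v, hv⟩ := exists_chi_lift i u
  have hvu : ∀ᵐ t ∂volume.restrict (Icc 0 T), (v t).toDist = u t := by
    filter_upwards [hu] with t ht using hv t ht
  refine ⟨v, memLp_weightedFourier_iff.1 ((memLp_congr_ae ?_).1 h), hvu⟩
  filter_upwards [hvu] with t ht
  rw [ht]

theorem MemLpChi.ae_chiENorm_lt_top (h : MemLpChi p i T u) :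
    ∀ᵐ t ∂volume.restrict (Icc 0 T), chiENorm i (u t) < ∞ := by
  obtain ⟨v, -, hvu⟩ := h
  filter_upwards [hvu] with t ht
  rw [← ht]
  exact (v t).2

theorem MemLpChi.memLp_weightedFourier (h : MemLpChi p i T u) :
    MemLp (fun t => weightedFourier i (u t)) p (volume.restrict (Icc 0 T)) := by
  obtain ⟨v, hv, hvu⟩ := h
  refine (memLp_congr_ae ?_).1 (memLp_weightedFourier_iff.2 hv)
  filter_upwards [hvu] with t ht
  rw [ht]

theorem MemLpChi.exists_eq_ofWeightedFourier (h : MemLpChi 2 0 T u) :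
    ∃ U : Lp (FourierL1 F) 2 (volume : Measure ℝ),
      U =ᵐ[volume] (Ioc 0 T).indicator (fun t => weightedFourier 0 (u t)) ∧
        ∀ᵐ t ∂volume.restrict (Icc 0 T), u t = ofWeightedFourier 0 (U t) := by
  have h_mem : MemLp ((Ioc 0 T).indicator fun t => weightedFourier 0 (u t)) 2 := by
    rw [memLp_indicator_iff_restrict measurableSet_Ioc, Measure.restrict_congr_set Ioc_ae_eq_Icc]
    exact h.memLp_weightedFourier
  refine ⟨h_mem.toLp, h_mem.coeFn_toLp, ae_restrict_Icc_iff.2 ?_⟩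
  filter_upwards [h_mem.coeFn_toLp, ae_restrict_Icc_iff.1 h.ae_chiENorm_lt_top] with t hUt h_fin ht
  rw [hUt, indicator_of_mem ht, ofWeightedFourier_weightedFourier (by simp) (h_fin ht)]

theorem continuousChi_of_weightedFourier
    (h : ContinuousOn (fun t => weightedFourier i (u t)) (Icc 0 T))
    (hu : ∀ t ∈ Icc 0 T, chiENorm i (u t) < ∞) : ContinuousChi i T u := by
  obtain ⟨v, hv⟩ := exists_chi_lift i u
  have hvu : ∀ t ∈ Icc 0 T, (v t).toDist = u t := fun t ht => hv t (hu t ht)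
  refine ⟨v, ?_, hvu⟩
  rw [(isometry_weightedFourier i).isEmbedding.isInducing.continuousOn_iff]
  refine h.congr fun t ht => ?_
  rw [Function.comp_apply, hvu t ht]

end TimeSpaces

section HeatSemigroup

variable {F : Type*} [NormedAddCommGroup F]

/-- The heat semigroup `e^{τΔ}` on the Fourier side, extended by the identity to `τ < 0`. -/
def heatL [NormedSpace ℝ F] (τ : ℝ) : FourierL1 F →L[ℝ] FourierL1 F :=
  mulLp F volume 1 (gauss (max τ 0))

section Real

variable [NormedSpace ℝ F]

theorem norm_gauss_max_le (τ : ℝ) (ξ : R3) : ‖gauss (max τ 0) ξ‖ ≤ 1 := by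
  rw [Real.norm_of_nonneg (gauss_pos _ _).le]
  exact gauss_le_one (le_max_right _ _) ξ

theorem memLp_gauss_max (τ : ℝ) : MemLp (gauss (max τ 0)) ∞ :=
  memLp_top_of_bound (continuous_gauss.uncurry_left _).aestronglyMeasurable 1
    (Eventually.of_forall (norm_gauss_max_le τ))

theorem coeFn_heatL (τ : ℝ) (f : FourierL1 F) :
    heatL τ f =ᵐ[volume] fun ξ => gauss (max τ 0) ξ • f ξ :=
  coeFn_mulLp (memLp_gauss_max τ) f

theorem continuous_heatL (f : FourierL1 F) : Continuous fun τ => heatL τ f := by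
  refine continuous_iff_continuousAt.2 fun τ => ?_
  refine tendsto_mulLp memLp_gauss_max (memLp_gauss_max τ) (C := 1)
    (Eventually.of_forall norm_gauss_max_le) (norm_gauss_max_le τ) (fun ξ => ?_) f
  have h_cont : Continuous fun τ : ℝ => gauss (max τ 0) ξ :=
    continuous_gauss.comp (by fun_prop : Continuous fun τ : ℝ => (max τ 0, ξ))
  exact h_cont.tendsto τ

theorem heatL_zero (f : FourierL1 F) : heatL 0 f = f := by
  refine Lp.ext ?_
  filter_upwards [coeFn_heatL 0 f] with ξ h
  simp [h, gauss]

theorem norm_heatL_le (τ : ℝ) (f : FourierL1 F) : ‖heatL τ f‖ ≤ ‖f‖ :=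
  (norm_mulLp_apply_le (memLp_gauss_max τ) (norm_gauss_max_le τ) f).trans_eq (one_mul _)

theorem kernelOp_zero_eq_heatL {ν τ : ℝ} (hν : 0 < ν) (hτ : 0 < τ) (f : FourierL1 F) :
    kernelOp ν 0 τ f = heatL (ν * τ) f := by
  refine Lp.ext ?_
  filter_upwards [coeFn_heatL (ν * τ) f, coeFn_kernelOp hν zero_le_two τ f] with ξ hξ hξ'
  rw [hξ, hξ', heatSymbol_of_pos hτ, max_eq_left (by positivity), pow_zero, one_mul]

end Real

theorem heat_ofWeightedFourier [NormedSpace ℂ F] [CompleteSpace F] {i : ℤ} (hi : i ∈ Icc (-2) 0)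
    {τ : ℝ} (hτ : 0 ≤ τ) (f : FourierL1 F) :
    heat τ (ofWeightedFourier i f) = ofWeightedFourier i (heatL τ f) := by
  refine eq_of_represents_fourier
    (represents_fourier_heat (represents_fourier_ofWeightedFourier hi f) hτ)
    ((represents_fourier_ofWeightedFourier hi (heatL τ f)).congr ?_)
  filter_upwards [coeFn_heatL τ f] with ξ h
  rw [h, max_eq_left hτ, smul_comm]

theorem heat_Q_apply (a : Coeffs) (U V : FourierL1 C3) {τ : ℝ} (hτ : 0 ≤ τ) (φ : 𝓢(R3, ℂ))
    (j : Fin 3) :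
    heat τ (Q a j (ofWeightedFourier 0 U) (ofWeightedFourier 0 V)) φ =
      pairing (-1) φ (heatL τ (qL a U V)) j := by
  have h := represents_fourier_heat (represents_fourier_Q a (L1.integrable_coeFn U)
    (L1.integrable_coeFn V) (represents_fourier_ofWeightedFourier_zero U)
    (represents_fourier_ofWeightedFourier_zero V) j) hτ
  rw [h.apply_eq_integral_fourierInv, pairing_apply (by norm_num)]
  refine integral_congr_ae ?_
  filter_upwards [coeFn_heatL τ (qL a U V), coeFn_qL a U V j] with ξ h_heat h_q
  rw [h_heat, PiLp.smul_apply, h_q, max_eq_left hτ, neg_neg, zpow_one, smul_eq_mul,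
    smul_comm (gauss τ ξ)]

end HeatSemigroup

section Evolution

variable {E : Type*} [NormedAddCommGroup E] [NormedSpace ℝ E] {ν : ℝ} {p : ℕ} {f₀ : FourierL1 E}
  {F : ℝ → FourierL1 E} {t : ℝ}

/-- The solution at time `t` of the heat equation `∂ₜf - νΔf = F` with data `f₀`, on the Fourier
side, provided that `F` vanishes at negative times. -/
def state (ν : ℝ) (f₀ : FourierL1 E) (F : ℝ → FourierL1 E) (t : ℝ) : FourierL1 E :=
  heatL (ν * t) f₀ + duhamel (kernelOp ν 0) F t

/-- The Duhamel formula for `|∇|^p` of the solution at time `t > 0` of the heat equation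
`∂ₜf - νΔf = F` with data `f₀`, on the Fourier side. -/
def evolution (ν : ℝ) (p : ℕ) (f₀ : FourierL1 E) (F : ℝ → FourierL1 E) (t : ℝ) : FourierL1 E :=
  kernelOp ν p t f₀ + duhamel (kernelOp ν p) F t

theorem norm_kernelOp_zero_le (hν : 0 < ν) (τ : ℝ) (f : FourierL1 E) :
    ‖kernelOp ν 0 τ f‖ ≤ ‖f‖ := by
  rcases le_or_gt τ 0 with hτ | hτ
  · rw [kernelOp_of_nonpos hτ, zero_apply, norm_zero]
    exact norm_nonneg _
  · rw [kernelOp_zero_eq_heatL hν hτ]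
    exact norm_heatL_le _ _

theorem duhamel_kernelOp_of_nonpos (hF : ∀ᵐ s, s ≤ 0 → F s = 0) (ht : t ≤ 0) :
    duhamel (kernelOp ν p) F t = 0 := by
  refine integral_eq_zero_of_ae ?_
  filter_upwards [hF] with s hs
  rcases le_total s 0 with h | h
  · rw [hs h, map_zero, Pi.zero_apply]
  · rw [kernelOp_of_nonpos (by linarith), zero_apply, Pi.zero_apply]

theorem state_zero (hF : ∀ᵐ s, s ≤ 0 → F s = 0) : state ν f₀ F 0 = f₀ := by
  rw [state, mul_zero, heatL_zero, duhamel_kernelOp_of_nonpos hF le_rfl, add_zero]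

/-- The symbol `|ξ|^p / (1 + |ξ|²)`, which is bounded for `p ≤ 2`. -/
def resolventSymbol (p : ℕ) (ξ : R3) : ℝ := (1 + ‖ξ‖ ^ 2)⁻¹ * ‖ξ‖ ^ p

theorem memLp_resolventSymbol (hp : p ≤ 2) : MemLp (resolventSymbol p) ∞ := by
  have h_meas : Measurable (resolventSymbol p) := by unfold resolventSymbol; fun_prop
  refine memLp_top_of_bound h_meas.aestronglyMeasurable 1 (Eventually.of_forall fun ξ => ?_)
  rw [resolventSymbol, Real.norm_of_nonneg (by positivity), inv_mul_le_one₀ (by positivity)]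
  exact pow_le_one_add_sq (norm_nonneg ξ) hp

theorem resolvent_kernelOp (hν : 0 < ν) (hp : p ≤ 2) (τ : ℝ) (f : FourierL1 E) :
    mulLp E volume 1 (resolventSymbol 0) (kernelOp ν p τ f) =
      mulLp E volume 1 (resolventSymbol p) (kernelOp ν 0 τ f) := by
  refine Lp.ext ?_
  filter_upwards [coeFn_mulLp (memLp_resolventSymbol zero_le_two) (kernelOp ν p τ f),
    coeFn_mulLp (memLp_resolventSymbol hp) (kernelOp ν 0 τ f), coeFn_kernelOp hν hp τ f,
    coeFn_kernelOp hν zero_le_two τ f] with ξ h_left h_right h_p h_zero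
  rw [h_left, h_right, h_p, h_zero, smul_smul, smul_smul]
  rcases le_or_gt τ 0 with hτ | hτ
  · rw [heatSymbol_of_nonpos hτ, heatSymbol_of_nonpos hτ, Pi.zero_apply, mul_zero, mul_zero]
  · rw [heatSymbol_of_pos hτ, heatSymbol_of_pos hτ, resolventSymbol, resolventSymbol]
    congr 1
    ring

variable [TopologicalSpace.SeparableSpace E]

theorem aestronglyMeasurable_kernelOp (hν : 0 < ν) (hp : p ≤ 2) (hF : Integrable F) (t : ℝ) :
    AEStronglyMeasurable fun s => kernelOp ν p (t - s) (F s) :=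
  aestronglyMeasurable_kernel_comp (H := kernelOp ν p) (stronglyMeasurable_kernelOp hν hp)
    (measurable_const.sub measurable_id) hF.aestronglyMeasurable

theorem integrable_kernelOp_zero (hν : 0 < ν) (hF : Integrable F) (t : ℝ) :
    Integrable fun s => kernelOp ν 0 (t - s) (F s) :=
  hF.mono (aestronglyMeasurable_kernelOp hν zero_le_two hF t)
    (Eventually.of_forall fun _ => norm_kernelOp_zero_le hν _ _)

theorem continuous_state (hν : 0 < ν) (f₀ : FourierL1 E) (hF : Integrable F) :
    Continuous (state ν f₀ F) := by
  refine ((continuous_heatL f₀).comp (continuous_const.mul continuous_id)).add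
    (continuous_iff_continuousAt.2 fun t => ?_)
  refine continuousAt_of_dominated (bound := fun s => ‖F s‖)
    (Eventually.of_forall fun r => (integrable_kernelOp_zero hν hF r).aestronglyMeasurable)
    (Eventually.of_forall fun r => Eventually.of_forall fun s => norm_kernelOp_zero_le hν _ _)
    hF.norm ?_
  filter_upwards [Measure.ae_ne volume t] with s hs
  have h_sub : Tendsto (fun r : ℝ => r - s) (𝓝 t) (𝓝 (t - s)) :=
    (continuous_id.sub continuous_const).tendsto t
  rcases lt_or_gt_of_ne hs with h | h
  · exact (continuousAt_kernelOp hν zero_le_two (F s) (sub_pos.2 h)).tendsto.comp h_sub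
  · refine continuousAt_const.congr (f := fun _ => (0 : FourierL1 E)) ?_
    filter_upwards [gt_mem_nhds h] with r hr
    rw [kernelOp_of_nonpos (sub_nonpos.2 hr.le), zero_apply]

theorem lintegral_lintegral_kernelOp_two_lt_top (hν : 0 < ν) (hF : Integrable F) :
    ∫⁻ t, ∫⁻ s, ‖kernelOp ν 2 (t - s) (F s)‖ₑ < ∞ :=
  (lintegral_lintegral_kernel_le (H := kernelOp ν 2) (stronglyMeasurable_kernelOp hν le_rfl)
    (lintegral_kernelOp_two_le hν) hF.aestronglyMeasurable).trans_lt
      (ENNReal.mul_lt_top ENNReal.ofReal_lt_top hF.hasFiniteIntegral)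

theorem ae_integrable_kernelOp_two (hν : 0 < ν) (hF : Integrable F) :
    ∀ᵐ t, Integrable fun s => kernelOp ν 2 (t - s) (F s) := by
  have h_meas := aestronglyMeasurable_kernel_sub_comp (H := kernelOp ν 2)
    (stronglyMeasurable_kernelOp hν le_rfl) hF.aestronglyMeasurable
  filter_upwards [ae_lt_top' h_meas.enorm.lintegral_prod_right'
    (lintegral_lintegral_kernelOp_two_lt_top hν hF).ne] with t ht
  exact ⟨aestronglyMeasurable_kernelOp hν le_rfl hF t, ht⟩

theorem integrable_evolution_two (hν : 0 < ν) (f₀ : FourierL1 E) (hF : Integrable F) :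
    Integrable (evolution ν 2 f₀ F) := by
  refine .add ⟨(stronglyMeasurable_kernelOp hν le_rfl f₀).aestronglyMeasurable,
    (lintegral_kernelOp_two_le hν f₀).trans_lt
      (ENNReal.mul_lt_top ENNReal.ofReal_lt_top enorm_lt_top)⟩ ⟨?_, ?_⟩
  · exact (aestronglyMeasurable_kernel_sub_comp (H := kernelOp ν 2)
      (stronglyMeasurable_kernelOp hν le_rfl) hF.aestronglyMeasurable).integral_prod_right'
  · exact (lintegral_mono fun t => enorm_integral_le_lintegral_enorm _).trans_lt
      (lintegral_lintegral_kernelOp_two_lt_top hν hF)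

/-- The unbounded multiplier `|ξ|^p` cannot be moved inside the Bochner integral; the bounded
multipliers `|ξ|^p / (1 + |ξ|²)` and `1 / (1 + |ξ|²)` can. -/
theorem coeFn_evolution [CompleteSpace E] (hν : 0 < ν) (hp : p ≤ 2) (hF : Integrable F)
    (ht : 0 < t) (h_int : Integrable fun s => kernelOp ν p (t - s) (F s)) :
    evolution ν p f₀ F t =ᵐ[volume] fun ξ => ‖ξ‖ ^ p • state ν f₀ F t ξ := by
  have h_resolvent : mulLp E volume 1 (resolventSymbol 0) (evolution ν p f₀ F t) =
      mulLp E volume 1 (resolventSymbol p) (state ν f₀ F t) := by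
    rw [state, evolution, map_add, map_add, map_duhamel _ _ h_int,
      map_duhamel _ _ (integrable_kernelOp_zero hν hF t)]
    simp only [resolvent_kernelOp hν hp, kernelOp_zero_eq_heatL hν ht]
  filter_upwards [coeFn_mulLp (memLp_resolventSymbol zero_le_two) (evolution ν p f₀ F t),
    coeFn_mulLp (memLp_resolventSymbol hp) (state ν f₀ F t)] with ξ h_left h_right
  rw [h_resolvent, h_right, resolventSymbol, resolventSymbol, pow_zero, mul_one, mul_smul] at h_left
  exact (smul_right_injective E (inv_ne_zero (by positivity)) h_left).symm

theorem map_duhamel_kernelOp_zero [CompleteSpace E] {X : Type*} [NormedAddCommGroup X]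
    [NormedSpace ℝ X] [CompleteSpace X] (ℓ : FourierL1 E →L[ℝ] X) (hν : 0 < ν)
    (hF : Integrable F) (hF_zero : ∀ᵐ s, s ≤ 0 → F s = 0) (ht : 0 ≤ t) :
    ℓ (duhamel (kernelOp ν 0) F t) = ∫ s in (0 : ℝ)..t, ℓ (heatL (ν * (t - s)) (F s)) := by
  rw [map_duhamel _ _ (integrable_kernelOp_zero hν hF t), intervalIntegral.integral_of_le ht,
    integral_Ioc_eq_integral_Ioo, ← integral_indicator measurableSet_Ioo]
  refine integral_congr_ae ?_
  filter_upwards [hF_zero] with s hs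
  by_cases hst : s ∈ Ioo 0 t
  · rw [indicator_of_mem hst, kernelOp_zero_eq_heatL hν (sub_pos.2 hst.2)]
  rw [indicator_of_notMem hst]
  rcases le_or_gt t s with h | h
  · rw [kernelOp_of_nonpos (sub_nonpos.2 h), zero_apply, map_zero]
  · rw [hs (not_lt.1 fun h_pos => hst ⟨h_pos, h⟩), map_zero, map_zero]

end Evolution

section StateDistribution

variable {F : Type*} [NormedAddCommGroup F] [NormedSpace ℂ F] [CompleteSpace F]
  [TopologicalSpace.SeparableSpace F] {ν : ℝ} {p : ℕ} {f₀ : FourierL1 F}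
  {G : ℝ → FourierL1 F} {t : ℝ}

theorem coeFn_evolution_zpow (hν : 0 < ν) (hp : p ≤ 2) (hG : Integrable G) (ht : 0 < t)
    (h_int : Integrable fun s => kernelOp ν p (t - s) (G s)) :
    evolution ν p f₀ G t =ᵐ[volume] fun ξ => ‖ξ‖ ^ ((p - 1 : ℤ) - -1) • state ν f₀ G t ξ := by
  simpa only [sub_neg_eq_add, sub_add_cancel, zpow_natCast] using
    coeFn_evolution (f₀ := f₀) hν hp hG ht h_int

theorem weightedFourier_ofWeightedFourier_state (hν : 0 < ν) (hp : p ≤ 2) (hG : Integrable G)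
    (ht : 0 < t) (h_int : Integrable fun s => kernelOp ν p (t - s) (G s)) :
    weightedFourier (p - 1) (ofWeightedFourier (-1) (state ν f₀ G t)) = evolution ν p f₀ G t :=
  weightedFourier_ofWeightedFourier_of_ae_eq (by simp) (coeFn_evolution_zpow hν hp hG ht h_int)

theorem memLpChi_ofWeightedFourier_state {r : ℝ≥0∞} (hν : 0 < ν) (hp : p ≤ 2) (hG : Integrable G)
    (h_int : ∀ᵐ t, Integrable fun s => kernelOp ν p (t - s) (G s))
    (h : MemLp (evolution ν p f₀ G) r) (T : ℝ) :
    MemLpChi r (p - 1) T fun t => ofWeightedFourier (-1) (state ν f₀ G t) := by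
  refine memLpChi_of_weightedFourier ((memLp_congr_ae (ae_restrict_Icc_iff.2 ?_)).2
    (h.restrict _)) (ae_restrict_Icc_iff.2 ?_)
  · filter_upwards [h_int] with t ht htT
    exact weightedFourier_ofWeightedFourier_state hν hp hG htT.1 ht
  · filter_upwards [h_int] with t ht htT
    rw [chiENorm_ofWeightedFourier_of_ae_eq (by simp) (coeFn_evolution_zpow hν hp hG htT.1 ht)]
    exact enorm_lt_top

theorem continuousChi_ofWeightedFourier_state (hν : 0 < ν) (f₀ : FourierL1 F)
    (hG : Integrable G) (T : ℝ) :
    ContinuousChi (-1) T fun t => ofWeightedFourier (-1) (state ν f₀ G t) := by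
  refine continuousChi_of_weightedFourier ?_
    fun t _ => chiENorm_ofWeightedFourier_lt_top (by simp) _
  simp only [weightedFourier_ofWeightedFourier (i := -1) (by simp)]
  exact (continuous_state hν f₀ hG).continuousOn

theorem memLpChi_top_ofWeightedFourier_state (hν : 0 < ν) (f₀ : FourierL1 F)
    (hG : Integrable G) (T : ℝ) :
    MemLpChi ∞ (-1) T fun t => ofWeightedFourier (-1) (state ν f₀ G t) := by
  have h_cont := continuous_state hν f₀ hG
  refine memLpChi_of_weightedFourier ?_
    (Eventually.of_forall fun t => chiENorm_ofWeightedFourier_lt_top (by simp) _)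
  simp only [weightedFourier_ofWeightedFourier (i := -1) (by simp)]
  obtain ⟨C, hC⟩ := isCompact_Icc.exists_bound_of_continuousOn (h_cont.continuousOn (s := Icc 0 T))
  exact memLp_top_of_bound h_cont.aestronglyMeasurable C
    (ae_restrict_of_forall_mem measurableSet_Icc hC)

end StateDistribution

section LinearPart

variable {E : Type*} [NormedAddCommGroup E] [NormedSpace ℝ E]
  [TopologicalSpace.SeparableSpace E] {ν : ℝ}

theorem memLp_kernelOp_one (hν : 0 < ν) (f₀ : FourierL1 E) :
    MemLp (fun t => kernelOp ν 1 t f₀) 2 :=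
  ⟨(stronglyMeasurable_kernelOp hν one_le_two f₀).aestronglyMeasurable,
    (eLpNorm_two_le_iff.2 (lintegral_sq_kernelOp_one_le hν f₀)).trans_lt
      (ENNReal.mul_lt_top ENNReal.coe_lt_top enorm_lt_top)⟩

/-- The Fourier transform, as a function of time, of the solution of the heat equation without
forcing; `f₀` is the Fourier transform of the data divided by `|ξ|`. -/
def linearPart (hν : 0 < ν) (f₀ : FourierL1 E) : Lp (FourierL1 E) 2 (volume : Measure ℝ) :=
  (memLp_kernelOp_one hν f₀).toLp

theorem norm_linearPart_le (hν : 0 < ν) (f₀ : FourierL1 E) :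
    ‖linearPart hν f₀‖ ≤ (heatKernel E hν).bound * ‖f₀‖ := by
  have h := ENNReal.toReal_mono (ENNReal.mul_lt_top ENNReal.coe_lt_top enorm_lt_top).ne
    (eLpNorm_two_le_iff.2 (lintegral_sq_kernelOp_one_le hν f₀))
  rw [linearPart, Lp.norm_toLp]
  rwa [ENNReal.toReal_mul, ENNReal.coe_toReal, toReal_enorm] at h

end LinearPart

section FourierSolution

variable {ν : ℝ} {a : Coeffs} {f₀ : FourierL1 C3} {U : Lp (FourierL1 C3) 2 (volume : Measure ℝ)}
  {t T : ℝ} {u : ℝ → 𝓢'(R3, C3)}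

/-- The nonlinear term `|∇|⁻¹ Q(u,u)` on the Fourier side, where `U` is the Fourier transform
of `u`. -/
def force (a : Coeffs) (U : Lp (FourierL1 C3) 2 (volume : Measure ℝ)) (s : ℝ) : FourierL1 C3 :=
  qL a (U s) (U s)

theorem force_ae_eq (a : Coeffs) (U : Lp (FourierL1 C3) 2 (volume : Measure ℝ)) :
    (qL a).holder 1 U U =ᵐ[volume] force a U := (qL a).coeFn_holder U U

theorem integrable_force (a : Coeffs) (U : Lp (FourierL1 C3) 2 (volume : Measure ℝ)) :
    Integrable (force a U) :=
  (memLp_one_iff_integrable.1 (Lp.memLp ((qL a).holder 1 U U))).congr (force_ae_eq a U)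

/-- `U` solves the Duhamel equation on `(0,T]`, on the Fourier side, and vanishes elsewhere; `f₀`
is the Fourier transform of the data divided by `|ξ|`. -/
abbrev IsFourierSolution (hν : 0 < ν) (a : Coeffs) (f₀ : FourierL1 C3) (T : ℝ)
    (U : Lp (FourierL1 C3) 2 (volume : Measure ℝ)) : Prop :=
  SolvesUpTo (heatKernel C3 hν).duhamelL (qL a) (linearPart hν f₀) T U

theorem isFourierSolution_iff (hν : 0 < ν) :
    IsFourierSolution hν a f₀ T U ↔
      U =ᵐ[volume] (Ioc 0 T).indicator (evolution ν 1 f₀ (force a U)) := by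
  have h_evolution : linearPart hν f₀ + (heatKernel C3 hν).duhamelL ((qL a).holder 1 U U)
      =ᵐ[volume] evolution ν 1 f₀ (force a U) := by
    filter_upwards [Lp.coeFn_add (linearPart hν f₀)
        ((heatKernel C3 hν).duhamelL ((qL a).holder 1 U U)),
      (memLp_kernelOp_one hν f₀).coeFn_toLp,
      (heatKernel C3 hν).coeFn_duhamelL ((qL a).holder 1 U U)] with t h_add h_linear h_duhamel
    rw [h_add, Pi.add_apply, h_duhamel, duhamel_congr _ (force_ae_eq a U), linearPart, h_linear]
    rfl
  have h_cutoff := (coeFn_cutoff (measurableSet_Ioc (a := 0) (b := T)) _).trans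
    h_evolution.indicator
  exact Lp.ext_iff.trans ⟨fun h => h.trans h_cutoff, fun h => h.trans h_cutoff.symm⟩

theorem IsFourierSolution.ae_eq_zero {hν : 0 < ν} (hU : IsFourierSolution hν a f₀ T U) :
    ∀ᵐ s, s ≤ 0 → U s = 0 := by
  filter_upwards [(isFourierSolution_iff hν).1 hU] with s hs h
  rw [hs, indicator_of_notMem fun h_mem => h_mem.1.not_ge h]

theorem force_ae_eq_zero (a : Coeffs) (hU : ∀ᵐ s, s ≤ 0 → U s = 0) :
    ∀ᵐ s, s ≤ 0 → force a U s = 0 := by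
  filter_upwards [hU] with s hs h
  rw [force, hs h, map_zero]

/-- The distribution-valued function with initial value `ofWeightedFourier (-1) f₀` given by the
Duhamel formula, where `U` is the Fourier transform of the solution in the nonlinear term. -/
def solutionOf (a : Coeffs) (ν : ℝ) (f₀ : FourierL1 C3)
    (U : Lp (FourierL1 C3) 2 (volume : Measure ℝ)) (t : ℝ) : 𝓢'(R3, C3) :=
  ofWeightedFourier (-1) (state ν f₀ (force a U) t)

theorem weightedFourier_solutionOf (hν : 0 < ν) :
    ∀ᵐ t, 0 < t → weightedFourier 0 (solutionOf a ν f₀ U t) = evolution ν 1 f₀ (force a U) t := by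
  filter_upwards [(heatKernel C3 hν).ae_integrable (integrable_force a U)] with t h_int ht
  exact weightedFourier_ofWeightedFourier_state (p := 1) hν one_le_two (integrable_force a U) ht
    h_int

theorem memLpChi_two_solutionOf (hν : 0 < ν) (T : ℝ) :
    MemLpChi 2 0 T (solutionOf a ν f₀ U) :=
  memLpChi_ofWeightedFourier_state (p := 1) hν one_le_two (integrable_force a U)
    ((heatKernel C3 hν).ae_integrable (integrable_force a U))
    ((memLp_kernelOp_one hν f₀).add
      ((heatKernel C3 hν).memLp_duhamel (memLp_one_iff_integrable.2 (integrable_force a U)))) T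

theorem memLpChi_one_solutionOf (hν : 0 < ν) (T : ℝ) :
    MemLpChi 1 1 T (solutionOf a ν f₀ U) :=
  memLpChi_ofWeightedFourier_state (p := 2) hν le_rfl (integrable_force a U)
    (ae_integrable_kernelOp_two hν (integrable_force a U))
    (memLp_one_iff_integrable.2 (integrable_evolution_two hν f₀ (integrable_force a U))) T

theorem IsFourierSolution.solutionOf_ae_eq {hν : 0 < ν} (hU : IsFourierSolution hν a f₀ T U) :
    ∀ᵐ t ∂volume.restrict (Icc 0 T), solutionOf a ν f₀ U t = ofWeightedFourier 0 (U t) := by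
  have h_fin := (memLpChi_two_solutionOf (a := a) (f₀ := f₀) (U := U) hν T).ae_chiENorm_lt_top
  refine ae_restrict_Icc_iff.2 ?_
  filter_upwards [(isFourierSolution_iff hν).1 hU, weightedFourier_solutionOf hν,
    ae_restrict_Icc_iff.1 h_fin] with t hUt h_weighted h_fin ht
  rw [hUt, indicator_of_mem ht, ← h_weighted ht.1,
    ofWeightedFourier_weightedFourier (by simp) (h_fin ht)]

theorem heat_add_integral_eq_solutionOf (hν : 0 < ν) (hU : ∀ᵐ s, s ≤ 0 → U s = 0)
    (hu : ∀ᵐ s ∂volume.restrict (Icc 0 T), u s = ofWeightedFourier 0 (U s)) (ht : t ∈ Icc 0 T)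
    (φ : 𝓢(R3, ℂ)) (j : Fin 3) :
    heat (ν * t) (ofWeightedFourier (-1) f₀) φ j +
        ∫ s in (0 : ℝ)..t, heat (ν * (t - s)) (Q a j (u s) (u s)) φ =
      solutionOf a ν f₀ U t φ j := by
  have h_integral : ∫ s in (0 : ℝ)..t, heat (ν * (t - s)) (Q a j (u s) (u s)) φ =
      ∫ s in (0 : ℝ)..t, pairing (-1) φ (heatL (ν * (t - s)) (force a U s)) j := by
    refine intervalIntegral.integral_congr_ae ?_
    filter_upwards [ae_restrict_Icc_iff.1 hu] with s hs hst
    rw [uIoc_of_le ht.1] at hst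
    rw [hs (Ioc_subset_Ioc_right ht.2 hst),
      heat_Q_apply a _ _ (mul_nonneg hν.le (sub_nonneg.2 hst.2)), force]
  have h_duhamel := map_duhamel_kernelOp_zero
    ((EuclideanSpace.proj j : C3 →L[ℂ] ℂ).restrictScalars ℝ ∘L pairing (-1) φ) hν
    (integrable_force a U) (force_ae_eq_zero a hU) ht.1
  rw [h_integral, heat_ofWeightedFourier (by simp) (mul_nonneg hν.le ht.1), solutionOf,
    ofWeightedFourier_apply (by simp), ofWeightedFourier_apply (by simp), state, map_add]
  exact congrArg _ h_duhamel.symm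

theorem IsFourierSolution.isRegularSolution {hν : 0 < ν} (hU : IsFourierSolution hν a f₀ T U) :
    IsRegularSolution a ν (ofWeightedFourier (-1) f₀) T (solutionOf a ν f₀ U) where
  mild := by
    refine ⟨memLpChi_two_solutionOf hν T, ?_⟩
    filter_upwards [ae_restrict_mem measurableSet_Icc] with t ht φ j
    exact (heat_add_integral_eq_solutionOf hν hU.ae_eq_zero hU.solutionOf_ae_eq ht φ j).symm
  initial := by rw [solutionOf, state_zero (force_ae_eq_zero a hU.ae_eq_zero)]
  continuous := continuousChi_ofWeightedFourier_state hν f₀ (integrable_force a U) T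
  memL1 := memLpChi_one_solutionOf hν T
  memLinfty := memLpChi_top_ofWeightedFourier_state hν f₀ (integrable_force a U) T

theorem IsMildSolution.exists_isFourierSolution (hν : 0 < ν)
    (hu : IsMildSolution a ν (ofWeightedFourier (-1) f₀) T u) :
    ∃ U, IsFourierSolution hν a f₀ T U ∧
      ∀ᵐ t ∂volume.restrict (Icc 0 T), u t = solutionOf a ν f₀ U t := by
  obtain ⟨U, hU, huU⟩ := hu.memLp.exists_eq_ofWeightedFourier
  have hU_zero : ∀ᵐ s, s ≤ 0 → U s = 0 := by
    filter_upwards [hU] with s hs h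
    rw [hs, indicator_of_notMem fun h_mem => h_mem.1.not_ge h]
  have hu_eq : ∀ᵐ t ∂volume.restrict (Icc 0 T), u t = solutionOf a ν f₀ U t := by
    filter_upwards [hu.duhamel, ae_restrict_mem measurableSet_Icc] with t h_duhamel ht
    ext φ j
    rw [h_duhamel φ j, heat_add_integral_eq_solutionOf hν hU_zero huU ht]
  refine ⟨U, (isFourierSolution_iff hν).2 ?_, hu_eq⟩
  filter_upwards [hU, ae_restrict_Icc_iff.1 hu_eq,
    weightedFourier_solutionOf (a := a) (f₀ := f₀) (U := U) hν] with t hUt hut h_weighted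
  rw [hUt]
  by_cases ht : t ∈ Ioc 0 T
  · rw [indicator_of_mem ht, indicator_of_mem ht, hut ht, h_weighted ht.1]
  · rw [indicator_of_notMem ht, indicator_of_notMem ht]

end FourierSolution

section Conjugation

/-- Componentwise complex conjugation. -/
def conj3 : C3 →L[ℝ] C3 :=
  (LinearIsometryEquiv.piLpCongrRight 2 fun _ : Fin 3 => Complex.conjLIE).toContinuousLinearEquiv

theorem conj3_apply (x : C3) (k : Fin 3) : conj3 x k = conj (x k) := rfl

/-- Complex conjugation of vector fields, on the Fourier side. -/
def conjL : FourierL1 C3 →L[ℝ] FourierL1 C3 :=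
  conj3.compLpL 1 volume ∘L (Lp.compMeasurePreservingₗᵢ ℝ (fun ξ : R3 => -ξ)
    (Measure.measurePreserving_neg volume)).toContinuousLinearMap

theorem ae_neg {P : R3 → Prop} (h : ∀ᵐ ξ, P ξ) : ∀ᵐ ξ, P (-ξ) :=
  (Measure.measurePreserving_neg volume).quasiMeasurePreserving.ae h

theorem coeFn_conjL (f : FourierL1 C3) : conjL f =ᵐ[volume] fun ξ => conj3 (f (-ξ)) := by
  have h_neg := Lp.coeFn_compMeasurePreserving f
    (Measure.measurePreserving_neg (volume : Measure R3))
  filter_upwards [conj3.coeFn_compLpL (Lp.compMeasurePreserving (fun ξ : R3 => -ξ)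
    (Measure.measurePreserving_neg volume) f), h_neg] with ξ h_conj h_neg
  exact h_conj.trans (congrArg conj3 h_neg)

theorem conjL_mulLp {σ : R3 → ℝ} (hσ : MemLp σ ∞) (h_even : ∀ ξ, σ (-ξ) = σ ξ)
    (f : FourierL1 C3) : conjL (mulLp C3 volume 1 σ f) = mulLp C3 volume 1 σ (conjL f) := by
  refine Lp.ext ?_
  filter_upwards [coeFn_conjL (mulLp C3 volume 1 σ f), ae_neg (coeFn_mulLp hσ f),
    coeFn_mulLp hσ (conjL f), coeFn_conjL f] with ξ h_conj_mul h_mul h_mul_conj h_conj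
  rw [h_conj_mul, h_mul, h_mul_conj, h_conj, map_smul, h_even]

theorem gauss_neg (τ : ℝ) (ξ : R3) : gauss τ (-ξ) = gauss τ ξ := by
  rw [gauss, gauss, norm_neg]

theorem heatSymbol_neg (ν : ℝ) (p : ℕ) (τ : ℝ) (ξ : R3) :
    heatSymbol ν p τ (-ξ) = heatSymbol ν p τ ξ := by
  rcases le_or_gt τ 0 with hτ | hτ
  · rw [heatSymbol_of_nonpos hτ, Pi.zero_apply, Pi.zero_apply]
  · rw [heatSymbol_of_pos hτ, heatSymbol_of_pos hτ, gauss_neg, norm_neg]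

theorem conjL_kernelOp {ν : ℝ} (hν : 0 < ν) {p : ℕ} (hp : p ≤ 2) (τ : ℝ) (f : FourierL1 C3) :
    conjL (kernelOp ν p τ f) = kernelOp ν p τ (conjL f) :=
  conjL_mulLp (memLp_heatSymbol hν hp τ) (heatSymbol_neg ν p τ) f

theorem conjL_heatL (τ : ℝ) (f : FourierL1 C3) : conjL (heatL τ f) = heatL τ (conjL f) :=
  conjL_mulLp (memLp_gauss_max τ) (gauss_neg _) f

theorem conj_qSymbol_neg (a : Coeffs) (j k l : Fin 3) (ξ : R3) :
    conj (qSymbol a j k l (-ξ)) = qSymbol a j k l ξ := by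
  simp only [qSymbol, map_sum, map_mul, Complex.conj_ofReal, Complex.conj_I, PiLp.neg_apply,
    norm_neg, map_ofNat]
  refine Finset.sum_congr rfl fun m _ => Finset.sum_congr rfl fun n _ =>
    Finset.sum_congr rfl fun p _ => ?_
  push_cast
  ring

theorem conj_conv_neg (f g : R3 → ℂ) (ξ : R3) :
    conj (conv f g (-ξ)) = conv (fun ξ => conj (f (-ξ))) (fun ξ => conj (g (-ξ))) ξ := by
  rw [conv, conv, convolution_def, convolution_def, ← integral_conj, ← integral_neg_eq_self]
  refine integral_congr_ae (Eventually.of_forall fun t => ?_)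
  have h_sub : -(ξ - t) = -ξ - -t := by abel
  simp [h_sub]

theorem conjL_qL (a : Coeffs) (U V : FourierL1 C3) :
    conjL (qL a U V) = qL a (conjL U) (conjL V) := by
  have h_comp : ∀ (W : FourierL1 C3) k,
      (fun ξ => conjL W ξ k) =ᵐ[volume] fun ξ => conj (W (-ξ) k) := fun W k => by
    filter_upwards [coeFn_conjL W] with ξ hξ
    rw [hξ, conj3_apply]
  refine Lp.ext ?_
  filter_upwards [coeFn_conjL (qL a U V), ae_all_iff.2 fun j => ae_neg (coeFn_qL a U V j),
    ae_all_iff.2 (coeFn_qL a (conjL U) (conjL V))] with ξ h_conj h_qL h_qL_conj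
  rw [h_conj]
  ext j
  rw [conj3_apply, h_qL, h_qL_conj]
  simp only [map_sum, map_mul, conj_qSymbol_neg, conj_conv_neg]
  refine Finset.sum_congr rfl fun k _ => Finset.sum_congr rfl fun l _ => ?_
  rw [conv, conv, convolution_congr _ (h_comp U k) (h_comp V l)]

theorem conj_fourierInv_of_real {φ : 𝓢(R3, ℂ)} (hφ : ∀ x, (φ x).im = 0) (ξ : R3) :
    conj ((𝓕⁻ φ) ξ) = (𝓕⁻ φ) (-ξ) := by
  rw [SchwartzMap.fourierInv_coe, Real.fourierInv_eq', Real.fourierInv_eq', ← integral_conj]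
  refine integral_congr_ae (Eventually.of_forall fun x => ?_)
  simp only [smul_eq_mul, map_mul, ← Complex.exp_conj, Complex.conj_ofReal, Complex.conj_I,
    inner_neg_right, Complex.conj_eq_iff_im.2 (hφ x)]
  congr 2
  push_cast
  ring

theorem conj_pairing {i : ℤ} (hi : i ≤ 0) {φ : 𝓢(R3, ℂ)} (hφ : ∀ x, (φ x).im = 0)
    (f : FourierL1 C3) (k : Fin 3) : conj (pairing i φ f k) = pairing i φ (conjL f) k := by
  rw [pairing_apply hi, pairing_apply hi, ← integral_conj, ← integral_neg_eq_self]
  refine integral_congr_ae ?_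
  filter_upwards [coeFn_conjL f] with ξ hξ
  rw [hξ, conj3_apply, map_mul, conj_fourierInv_of_real hφ, neg_neg, norm_neg,
    Complex.real_smul, Complex.real_smul, map_mul, Complex.conj_ofReal]

theorem exists_real_imag_schwartz (φ : 𝓢(R3, ℂ)) : ∃ φ₁ φ₂ : 𝓢(R3, ℂ),
    (∀ x, (φ₁ x).im = 0) ∧ (∀ x, (φ₂ x).im = 0) ∧ φ = φ₁ + Complex.I • φ₂ := by
  refine ⟨φ.postcompCLM (Complex.ofRealCLM ∘L Complex.reCLM),
    φ.postcompCLM (Complex.ofRealCLM ∘L Complex.imCLM), fun _ => ?_, fun _ => ?_, ?_⟩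
  · simp
  · simp
  · ext x
    simp [mul_comm Complex.I, Complex.re_add_im]

theorem isRealField_ofWeightedFourier_iff {i : ℤ} (hi : i ∈ Icc (-2) 0) {f : FourierL1 C3} :
    IsRealField (ofWeightedFourier i f) ↔ conjL f = f := by
  refine ⟨fun h => ?_, fun h φ hφ k => ?_⟩
  · have h_real : ∀ φ : 𝓢(R3, ℂ), (∀ x, (φ x).im = 0) →
        ofWeightedFourier i (conjL f) φ = ofWeightedFourier i f φ := fun φ hφ => by
      ext k
      rw [ofWeightedFourier_apply hi, ← conj_pairing hi.2 hφ, ← ofWeightedFourier_apply hi,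
        Complex.conj_eq_iff_im]
      exact h φ hφ k
    have h_eq : ofWeightedFourier i (conjL f) = ofWeightedFourier i f := by
      ext1 φ
      obtain ⟨φ₁, φ₂, h₁, h₂, rfl⟩ := exists_real_imag_schwartz φ
      rw [map_add, map_add, map_smul, map_smul, h_real φ₁ h₁, h_real φ₂ h₂]
    rw [← weightedFourier_ofWeightedFourier hi (conjL f), h_eq,
      weightedFourier_ofWeightedFourier hi]
  · rw [ofWeightedFourier_apply hi, ← Complex.conj_eq_iff_im, conj_pairing hi.2 hφ, h]

theorem conjL_duhamel {ν : ℝ} (hν : 0 < ν) {p : ℕ} (hp : p ≤ 2) {F : ℝ → FourierL1 C3} {t : ℝ}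
    (h_int : Integrable fun s => kernelOp ν p (t - s) (F s)) :
    conjL (duhamel (kernelOp ν p) F t) = duhamel (kernelOp ν p) (fun s => conjL (F s)) t := by
  rw [map_duhamel conjL (kernelOp ν p) h_int, duhamel]
  simp only [conjL_kernelOp hν hp]

variable {ν : ℝ} {hν : 0 < ν} {a : Coeffs} {f₀ : FourierL1 C3}
  {U : Lp (FourierL1 C3) 2 (volume : Measure ℝ)} {T : ℝ}

theorem conjL_force (a : Coeffs) (U : Lp (FourierL1 C3) 2 (volume : Measure ℝ)) :
    (fun s => conjL (force a U s)) =ᵐ[volume] force a (conjL.compLp U) := by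
  filter_upwards [conjL.coeFn_compLp U] with s hs
  rw [force, force, hs, conjL_qL]

theorem IsFourierSolution.conj (hU : IsFourierSolution hν a f₀ T U) :
    IsFourierSolution hν a (conjL f₀) T (conjL.compLp U) := by
  refine (isFourierSolution_iff hν).2 ?_
  filter_upwards [conjL.coeFn_compLp U, (isFourierSolution_iff hν).1 hU,
    (heatKernel C3 hν).ae_integrable (integrable_force a U)] with t h_conj hUt h_int
  rw [h_conj, hUt]
  by_cases ht : t ∈ Ioc 0 T
  · rw [indicator_of_mem ht, indicator_of_mem ht, evolution, map_add, conjL_kernelOp hν one_le_two,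
      conjL_duhamel hν one_le_two h_int, duhamel_congr _ (conjL_force a U), evolution]
  · rw [indicator_of_notMem ht, indicator_of_notMem ht, map_zero]

theorem IsFourierSolution.isRealField_solutionOf (hU : IsFourierSolution hν a f₀ T U)
    (hT : 0 ≤ T) (hf₀ : conjL f₀ = f₀) (t : ℝ) : IsRealField (solutionOf a ν f₀ U t) := by
  have h_conj := hU.conj
  rw [hf₀] at h_conj
  have hU_real : conjL.compLp U = U :=
    SolvesUpTo.unique (heatKernel C3 hν).isCausal_duhamelL hT h_conj hU
  have h_force := conjL_force a U
  rw [hU_real] at h_force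
  refine (isRealField_ofWeightedFourier_iff (by simp)).2 ?_
  rw [state, map_add, conjL_heatL, hf₀, conjL_duhamel hν zero_le_two
    (integrable_kernelOp_zero hν (integrable_force a U) t), duhamel_congr _ h_force]

end Conjugation

section Limits

theorem exists_seq_Ioo_subset_iUnion_Icc {S : ℝ} (hS : 0 < S) :
    ∃ r : ℕ → ℝ, (∀ n, r n ∈ Ioo 0 S) ∧ Ioo 0 S ⊆ ⋃ n, Icc 0 (r n) := by
  obtain ⟨r, -, hr, hrS⟩ := exists_seq_strictMono_tendsto' hS
  refine ⟨r, hr, fun t ht => ?_⟩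
  obtain ⟨n, hn⟩ := (hrS.eventually (lt_mem_nhds ht.2)).exists
  exact mem_iUnion.2 ⟨n, ht.1.le, hn.le⟩

theorem ae_restrict_Icc_of_forall_lt {S : ℝ} (hS : 0 < S) {P : ℝ → Prop}
    (h : ∀ T ∈ Ioo 0 S, ∀ᵐ t ∂volume.restrict (Icc 0 T), P t) :
    ∀ᵐ t ∂volume.restrict (Icc 0 S), P t := by
  obtain ⟨r, hr, h_cover⟩ := exists_seq_Ioo_subset_iUnion_Icc hS
  rw [← Measure.restrict_congr_set Ioo_ae_eq_Icc]
  exact ae_restrict_of_ae_restrict_of_subset h_cover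
    ((ae_restrict_iUnion_iff _ _).2 fun n => h (r n) (hr n))

theorem aestronglyMeasurable_restrict_Icc_of_forall_lt {E : Type*} [TopologicalSpace E]
    [TopologicalSpace.PseudoMetrizableSpace E] {S : ℝ} (hS : 0 < S) {f : ℝ → E}
    (h : ∀ T ∈ Ioo 0 S, AEStronglyMeasurable f (volume.restrict (Icc 0 T))) :
    AEStronglyMeasurable f (volume.restrict (Icc 0 S)) := by
  obtain ⟨r, hr, h_cover⟩ := exists_seq_Ioo_subset_iUnion_Icc hS
  rw [← Measure.restrict_congr_set Ioo_ae_eq_Icc]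
  exact (AEStronglyMeasurable.iUnion fun n => h (r n) (hr n)).mono_set h_cover

theorem memLpChi_of_forall_lt {F : Type*} [NormedAddCommGroup F] [NormedSpace ℂ F]
    [CompleteSpace F] {p : ℝ≥0∞} {i : ℤ} {S : ℝ} {u : ℝ → 𝓢'(R3, F)} (hp : p ≠ 0) (hp' : p ≠ ∞)
    (hS : 0 < S) (h : ∀ T ∈ Ioo 0 S, MemLpChi p i T u)
    (h_fin : ∫⁻ t in Icc 0 S, chiENorm i (u t) ^ p.toReal < ∞) : MemLpChi p i S u := by
  have h_lt_top : ∀ᵐ t ∂volume.restrict (Icc 0 S), chiENorm i (u t) < ∞ :=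
    ae_restrict_Icc_of_forall_lt hS fun T hT => (h T hT).ae_chiENorm_lt_top
  refine memLpChi_of_weightedFourier ⟨aestronglyMeasurable_restrict_Icc_of_forall_lt hS
    fun T hT => (h T hT).memLp_weightedFourier.1, ?_⟩ h_lt_top
  rw [eLpNorm_lt_top_iff_lintegral_rpow_enorm_lt_top hp hp']
  refine (lintegral_congr_ae ?_).trans_lt h_fin
  filter_upwards [h_lt_top] with t ht
  rw [enorm_weightedFourier ht]

end Limits

section Congruence

theorem MemLpChi.congr_ae {F : Type*} [NormedAddCommGroup F] [NormedSpace ℂ F] [CompleteSpace F]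
    {p : ℝ≥0∞} {i : ℤ} {T : ℝ} {u v : ℝ → 𝓢'(R3, F)} (hu : MemLpChi p i T u)
    (h : u =ᵐ[volume.restrict (Icc 0 T)] v) : MemLpChi p i T v := by
  obtain ⟨w, hw, hwu⟩ := hu
  exact ⟨w, hw, EventuallyEq.trans hwu h⟩

variable {a : Coeffs} {ν T : ℝ} {u₀ : 𝓢'(R3, C3)} {u v : ℝ → 𝓢'(R3, C3)}

theorem IsMildSolution.congr_ae (hu : IsMildSolution a ν u₀ T u)
    (h : u =ᵐ[volume.restrict (Icc 0 T)] v) : IsMildSolution a ν u₀ T v := by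
  refine ⟨hu.memLp.congr_ae h, ?_⟩
  filter_upwards [hu.duhamel, h, ae_restrict_mem measurableSet_Icc] with t h_duhamel h_eq ht φ j
  have h_integral : ∫ s in (0 : ℝ)..t, heat (ν * (t - s)) (Q a j (u s) (u s)) φ =
      ∫ s in (0 : ℝ)..t, heat (ν * (t - s)) (Q a j (v s) (v s)) φ := by
    refine intervalIntegral.integral_congr_ae ?_
    filter_upwards [ae_restrict_Icc_iff.1 h] with s hs hst
    rw [uIoc_of_le ht.1] at hst
    rw [hs (Ioc_subset_Ioc_right ht.2 hst)]
  rw [← h_eq, h_duhamel φ j, h_integral]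

theorem IsRegularSolution.congr (hT : 0 ≤ T) (hu : IsRegularSolution a ν u₀ T u)
    (h : EqOn u v (Icc 0 T)) : IsRegularSolution a ν u₀ T v := by
  have h_ae : u =ᵐ[volume.restrict (Icc 0 T)] v := ae_restrict_of_forall_mem measurableSet_Icc h
  obtain ⟨w, hw, hwu⟩ := hu.continuous
  exact ⟨hu.mild.congr_ae h_ae, (h (left_mem_Icc.2 hT)).symm.trans hu.initial,
    ⟨w, hw, fun t ht => (hwu t ht).trans (h ht)⟩, hu.memL1.congr_ae h_ae,
    hu.memLinfty.congr_ae h_ae⟩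

end Congruence

section MaximalSolution

variable {ν : ℝ} {hν : 0 < ν} {a : Coeffs} {f₀ : FourierL1 C3}
  {U U' : Lp (FourierL1 C3) 2 (volume : Measure ℝ)} {T T' : ℝ} {v : ℝ → 𝓢'(R3, C3)}

theorem IsFourierSolution.force_ae_eq (hT : 0 ≤ T) (hTT' : T ≤ T')
    (hU : IsFourierSolution hν a f₀ T U) (hU' : IsFourierSolution hν a f₀ T' U') :
    ∀ᵐ s, s ≤ T → force a U s = force a U' s := by
  have hD := (heatKernel C3 hν).isCausal_duhamelL
  have hU_eq : U = cutoff (Ioc 0 T) U' := hU.unique hD hT (hU'.restrict hD hTT')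
  filter_upwards [coeFn_cutoff measurableSet_Ioc U', hU'.ae_eq_zero] with s h_cutoff h_zero hs
  rw [hU_eq, force, force, h_cutoff]
  rcases le_or_gt s 0 with hs₀ | hs₀
  · rw [indicator_of_notMem fun h_mem => h_mem.1.not_ge hs₀, h_zero hs₀]
  · rw [indicator_of_mem (mem_Ioc.2 ⟨hs₀, hs⟩)]

theorem IsFourierSolution.eqOn_solutionOf (hT : 0 ≤ T) (hTT' : T ≤ T')
    (hU : IsFourierSolution hν a f₀ T U) (hU' : IsFourierSolution hν a f₀ T' U') :
    EqOn (solutionOf a ν f₀ U) (solutionOf a ν f₀ U') (Iic T) := by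
  intro t ht
  have h_duhamel : duhamel (kernelOp ν 0) (force a U) t =
      duhamel (kernelOp ν 0) (force a U') t := by
    refine integral_congr_ae ?_
    filter_upwards [hU.force_ae_eq hT hTT' hU'] with s hs
    rcases le_or_gt s T with hsT | hsT
    · rw [hs hsT]
    · rw [kernelOp_of_nonpos (sub_nonpos.2 (ht.trans hsT.le)), zero_apply, zero_apply]
  rw [solutionOf, solutionOf, state, state, h_duhamel]

theorem IsMildSolution.ae_eq_solutionOf (hT : 0 ≤ T)
    (hv : IsMildSolution a ν (ofWeightedFourier (-1) f₀) T v)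
    (hU : IsFourierSolution hν a f₀ T U) :
    v =ᵐ[volume.restrict (Icc 0 T)] solutionOf a ν f₀ U := by
  obtain ⟨V, hV, hvV⟩ := hv.exists_isFourierSolution hν
  obtain rfl : V = U := hV.unique (heatKernel C3 hν).isCausal_duhamelL hT hU
  exact hvV

open Classical in
/-- The solution on the union of all intervals `[0,T)` on which there is one, and zero elsewhere;
`f₀` is the Fourier transform of the data divided by `|ξ|`. -/
def maximalSolution (hν : 0 < ν) (a : Coeffs) (f₀ : FourierL1 C3) (t : ℝ) : 𝓢'(R3, C3) :=
  if h : ∃ U T, IsFourierSolution hν a f₀ T U ∧ t ∈ Ico 0 T then solutionOf a ν f₀ h.choose t else 0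

theorem IsFourierSolution.eqOn_maximalSolution (hU : IsFourierSolution hν a f₀ T U) :
    EqOn (maximalSolution hν a f₀) (solutionOf a ν f₀ U) (Ico 0 T) := by
  intro t ht
  have h : ∃ U T, IsFourierSolution hν a f₀ T U ∧ t ∈ Ico 0 T := ⟨U, T, hU, ht⟩
  obtain ⟨T', hU', ht'⟩ := h.choose_spec
  rw [maximalSolution, dif_pos h]
  rcases le_total T T' with hle | hle
  · exact (hU.eqOn_solutionOf (ht.1.trans ht.2.le) hle hU' ht.2.le).symm
  · exact hU'.eqOn_solutionOf (ht'.1.trans ht'.2.le) hle hU ht'.2.le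

theorem IsMildSolution.ae_eq_maximalSolution (hT : 0 ≤ T)
    (hv : IsMildSolution a ν (ofWeightedFourier (-1) f₀) T v) :
    v =ᵐ[volume.restrict (Icc 0 T)] maximalSolution hν a f₀ := by
  obtain ⟨U, hU, -⟩ := hv.exists_isFourierSolution hν
  refine (hv.ae_eq_solutionOf hT hU).trans ?_
  rw [← Measure.restrict_congr_set Ico_ae_eq_Icc]
  exact ae_restrict_of_forall_mem measurableSet_Ico fun t ht => (hU.eqOn_maximalSolution ht).symm

end MaximalSolution

section Lifespan

variable {ν : ℝ} {hν : 0 < ν} {a : Coeffs} {f₀ : FourierL1 C3}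
  {U : Lp (FourierL1 C3) 2 (volume : Measure ℝ)} {T : ℝ}

theorem IsFourierSolution.ofReal_le_lifespan (hU : IsFourierSolution hν a f₀ T U) (hT : 0 < T) :
    ENNReal.ofReal T ≤ lifespan a ν (ofWeightedFourier (-1) f₀) :=
  le_iSup₂_of_le T ⟨hT, _, hU.isRegularSolution⟩ le_rfl

theorem exists_isFourierSolution_of_lt_lifespan (hν : 0 < ν) (hT : 0 ≤ T)
    (h : ENNReal.ofReal T < lifespan a ν (ofWeightedFourier (-1) f₀)) :
    ∃ T' > T, ∃ U, IsFourierSolution hν a f₀ T' U := by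
  simp only [lifespan, lt_iSup_iff] at h
  obtain ⟨T', ⟨-, u, hu⟩, hlt⟩ := h
  obtain ⟨U, hU, -⟩ := hu.mild.exists_isFourierSolution hν
  exact ⟨T', (ENNReal.ofReal_lt_ofReal_iff_of_nonneg hT).1 hlt, U, hU⟩

theorem IsFourierSolution.ofReal_lt_lifespan (hU : IsFourierSolution hν a f₀ T U) (hT : 0 ≤ T) :
    ENNReal.ofReal T < lifespan a ν (ofWeightedFourier (-1) f₀) := by
  obtain ⟨T', hT', U', hU'⟩ :=
    SolvesUpTo.exists_extension (heatKernel C3 hν).isCausal_duhamelL hT hU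
  exact ((ENNReal.ofReal_lt_ofReal_iff_of_nonneg hT).2 hT').trans_le
    (IsFourierSolution.ofReal_le_lifespan hU' (hT.trans_lt hT'))

theorem lifespan_pos (hν : 0 < ν) (a : Coeffs) (f₀ : FourierL1 C3) :
    0 < lifespan a ν (ofWeightedFourier (-1) f₀) := by
  have h_zero : IsFourierSolution hν a f₀ 0 0 := solvesUpTo_zero
  simpa only [ENNReal.ofReal_zero] using h_zero.ofReal_lt_lifespan le_rfl

theorem sq_bound_heatKernel (hν : 0 < ν) :
    ((heatKernel C3 hν).bound : ℝ) ^ 2 = 1 / (8 * Real.pi ^ 2 * ν) := by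
  have h_bound : ((heatKernel C3 hν).bound : ℝ) = √(1 / (8 * Real.pi ^ 2 * ν)) :=
    Real.coe_toNNReal _ (Real.sqrt_nonneg _)
  rw [h_bound, Real.sq_sqrt (by positivity)]

theorem four_mul_norm_linearPart_lt_one (hν : 0 < ν)
    (h : ‖f₀‖ ≤ Real.pi ^ 2 / (‖qL a‖ + 1) * ν) :
    4 * (‖(heatKernel C3 hν).duhamelL‖ * ‖qL a‖) * ‖linearPart hν f₀‖ < 1 := by
  set β := ((heatKernel C3 hν).bound : ℝ)
  have h_duhamel : ‖(heatKernel C3 hν).duhamelL‖ ≤ β := (heatKernel C3 hν).norm_duhamelL_le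
  have h_linear : ‖linearPart hν f₀‖ ≤ β * (Real.pi ^ 2 / (‖qL a‖ + 1) * ν) :=
    (norm_linearPart_le hν f₀).trans (by gcongr)
  calc 4 * (‖(heatKernel C3 hν).duhamelL‖ * ‖qL a‖) * ‖linearPart hν f₀‖
      ≤ 4 * (β * ‖qL a‖) * (β * (Real.pi ^ 2 / (‖qL a‖ + 1) * ν)) := by gcongr
    _ = 4 * β ^ 2 * (Real.pi ^ 2 * ν) * (‖qL a‖ / (‖qL a‖ + 1)) := by ring
    _ = 1 / 2 * (‖qL a‖ / (‖qL a‖ + 1)) := by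
        rw [sq_bound_heatKernel hν]
        field_simp
        ring
    _ ≤ 1 / 2 * 1 := by
        gcongr
        exact div_le_one_of_le₀ (by linarith) (by positivity)
    _ < 1 := by norm_num

theorem lifespan_eq_top_of_norm_le (hν : 0 < ν) (h : ‖f₀‖ ≤ Real.pi ^ 2 / (‖qL a‖ + 1) * ν) :
    lifespan a ν (ofWeightedFourier (-1) f₀) = ∞ := by
  refine ENNReal.eq_top_of_forall_nnreal_le fun r => ?_
  obtain ⟨U, hU⟩ := exists_solvesUpTo_of_small (four_mul_norm_linearPart_lt_one hν h) r
  rw [← ENNReal.ofReal_coe_nnreal]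
  exact (IsFourierSolution.ofReal_lt_lifespan hU r.2).le

theorem isRegularSolution_maximalSolution (hν : 0 < ν) (hT : 0 ≤ T)
    (h : ENNReal.ofReal T < lifespan a ν (ofWeightedFourier (-1) f₀)) :
    IsRegularSolution a ν (ofWeightedFourier (-1) f₀) T (maximalSolution hν a f₀) := by
  obtain ⟨T', hTT', U, hU⟩ := exists_isFourierSolution_of_lt_lifespan hν hT h
  have h_restrict : IsFourierSolution hν a f₀ T (cutoff (Ioc 0 T) U) :=
    SolvesUpTo.restrict (heatKernel C3 hν).isCausal_duhamelL hU hTT'.le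
  refine h_restrict.isRegularSolution.congr hT fun t ht => ?_
  rw [hU.eqOn_maximalSolution ⟨ht.1, ht.2.trans_lt hTT'⟩,
    h_restrict.eqOn_solutionOf hT hTT'.le hU ht.2]

theorem isRealField_maximalSolution (hν : 0 < ν)
    (h_real : IsRealField (ofWeightedFourier (-1) f₀)) (hT : 0 ≤ T)
    (h : ENNReal.ofReal T < lifespan a ν (ofWeightedFourier (-1) f₀)) :
    IsRealField (maximalSolution hν a f₀ T) := by
  obtain ⟨T', hTT', U, hU⟩ := exists_isFourierSolution_of_lt_lifespan hν hT h
  rw [hU.eqOn_maximalSolution ⟨hT, hTT'⟩]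
  exact hU.isRealField_solutionOf (hT.trans hTT'.le)
    ((isRealField_ofWeightedFourier_iff (by simp)).1 h_real) T

theorem lintegral_maximalSolution_eq_top (hν : 0 < ν)
    (h : lifespan a ν (ofWeightedFourier (-1) f₀) < ∞) :
    ∫⁻ t in Ico 0 (lifespan a ν (ofWeightedFourier (-1) f₀)).toReal,
      chiENorm 0 (maximalSolution hν a f₀ t) ^ 2 = ∞ := by
  set u := maximalSolution hν a f₀
  obtain ⟨S, hS⟩ : ∃ S, S = (lifespan a ν (ofWeightedFourier (-1) f₀)).toReal := ⟨_, rfl⟩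
  have hS_pos : 0 < S := hS ▸ ENNReal.toReal_pos (lifespan_pos hν a f₀).ne' h.ne
  have h_ofReal : ENNReal.ofReal S = lifespan a ν (ofWeightedFourier (-1) f₀) :=
    hS ▸ ENNReal.ofReal_toReal h.ne
  have h_mild : ∀ T ∈ Ioo 0 S, IsMildSolution a ν (ofWeightedFourier (-1) f₀) T u :=
    fun T hT => (isRegularSolution_maximalSolution hν hT.1.le
      (h_ofReal ▸ (ENNReal.ofReal_lt_ofReal_iff_of_nonneg hT.1.le).2 hT.2)).mild
  rw [← hS, Measure.restrict_congr_set Ico_ae_eq_Icc]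
  by_contra h_fin
  have h_mild_S : IsMildSolution a ν (ofWeightedFourier (-1) f₀) S u :=
    ⟨memLpChi_of_forall_lt two_ne_zero ENNReal.ofNat_ne_top hS_pos (fun T hT => (h_mild T hT).memLp)
      (by simpa using Ne.lt_top h_fin),
      ae_restrict_Icc_of_forall_lt hS_pos fun T hT => (h_mild T hT).duhamel⟩
  obtain ⟨U, hU, -⟩ := h_mild_S.exists_isFourierSolution hν
  exact (hU.ofReal_lt_lifespan hS_pos.le).ne h_ofReal

end Lifespan

end GNS

end

theorem theorem1p1 (a : GNS.Coeffs) :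
    ∃ C : ℝ, 0 < C ∧ ∀ (ν : ℝ), 0 < ν → ∀ u₀ : GNS.Chi GNS.C3 (-1),
      -- local existence and uniqueness
      (∃ T : ℝ, 0 < T ∧ ∃ u, GNS.IsRegularSolution a ν u₀.toDist T u ∧
        ∀ v, GNS.IsMildSolution a ν u₀.toDist T v → v =ᵐ[volume.restrict (Icc 0 T)] u) ∧
      -- smallness implies global existence
      (‖u₀‖ ≤ C * ν → GNS.lifespan a ν u₀.toDist = ∞) ∧
      -- the maximal solution
      ∃ u : ℝ → 𝓢'(GNS.R3, GNS.C3),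
        (∀ T : ℝ, 0 < T → ENNReal.ofReal T < GNS.lifespan a ν u₀.toDist →
          GNS.IsRegularSolution a ν u₀.toDist T u) ∧
        -- uniqueness on every time interval
        (∀ T : ℝ, 0 < T → ∀ v, GNS.IsMildSolution a ν u₀.toDist T v →
          v =ᵐ[volume.restrict (Icc 0 T)] u) ∧
        -- real data have real solutions
        (GNS.IsRealField u₀.toDist → ∀ t : ℝ, 0 ≤ t →
          ENNReal.ofReal t < GNS.lifespan a ν u₀.toDist → GNS.IsRealField (u t)) ∧
        -- blow-up criterion
        (GNS.lifespan a ν u₀.toDist < ∞ →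
          ∫⁻ t in Ico 0 (GNS.lifespan a ν u₀.toDist).toReal, GNS.chiENorm 0 (u t) ^ 2 = ∞) := by
  refine ⟨Real.pi ^ 2 / (‖GNS.qL a‖ + 1), by positivity, fun ν hν u₀ => ?_⟩
  obtain ⟨f₀, hf₀, h_norm⟩ : ∃ f₀ : GNS.FourierL1 GNS.C3,
      GNS.ofWeightedFourier (-1) f₀ = u₀.toDist ∧ ‖f₀‖ = ‖u₀‖ :=
    ⟨GNS.weightedFourier (-1) u₀.toDist, GNS.ofWeightedFourier_weightedFourier (by simp) u₀.2,
      GNS.norm_weightedFourier u₀⟩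
  rw [← hf₀, ← h_norm]
  obtain ⟨T, hT, hT_pos, hT_lt⟩ :=
    ENNReal.lt_iff_exists_real_btwn.1 (GNS.lifespan_pos hν a f₀)
  exact ⟨⟨T, ENNReal.ofReal_pos.1 hT_pos, GNS.maximalSolution hν a f₀,
      GNS.isRegularSolution_maximalSolution hν hT hT_lt, fun _ hv => hv.ae_eq_maximalSolution hT⟩,
    GNS.lifespan_eq_top_of_norm_le hν, GNS.maximalSolution hν a f₀,
    fun _ hT' => GNS.isRegularSolution_maximalSolution hν hT'.le,
    fun _ hT' _ hv => hv.ae_eq_maximalSolution hT'.le,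
    fun h_real _ ht => GNS.isRealField_maximalSolution hν h_real ht,
    GNS.lintegral_maximalSolution_eq_top hν⟩
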